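/- Let $\mathcal{A}$ be a complex Banach algebra with unit $I$, $|I|=1$, let $A\in\mathcal{A}$, and let $\sigma(A)\subset\mathbb{C}$ be its spectrum. Loops are piecewise $C^1$ closed curves in $\mathbb{C}$, and a cycle $\Gamma$ is a finite formal sum of loops with integer coefficients; $\mathrm{Ind}(\Gamma,\zeta)=\frac{1}{2\pi i}\int_\Gamma\frac{dz}{z-\zeta}$ is its index about a point $\zeta$ not on $\Gamma$. For an open set $\Omega\supseteq\sigma(A)$, we say that $\Gamma$ surrounds $\sigma(A)$ in $\Omega$ if $\Gamma$ lies in $\Omega\setminus\sigma(A)$, $\mathrm{Ind}(\Gamma,\zeta)=1$ for all $\zeta\in\sigma(A)$, and $\mathrm{Ind}(\Gamma,\zeta)=0$ for all $\zeta\notin\Omega$. If $f$ is holomorphic on an open set $\Omega\supseteq\sigma(A)$, define $$f(A):=\frac{1}{2\pi i}\int_\Gamma (zI-A)^{-1}f(z)\,dz,$$ where $\Gamma$ is any cycle that surrounds $\sigma(A)$ in $\Omega$. Such cycles exist for every open $\Omega\supseteq\sigma(A)$, and $f(A)$ does not depend on the choice of $\Gamma$ and of the open set $\Omega\supseteq\sigma(A)$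 on which $f$ is holomorphic. Moreover: (i) If $q(z)=\sum_{j=0}^n\alpha_jz^j$ is a polynomial, then $q(A)=\sum_{j=0}^n\alpha_jA^j$. More generally, if the power series $f(z)=\sum_{n=0}^\infty\alpha_nz^n$ has radius of convergence $R\in(0,\infty]$ greater than the spectral radius of $A$, then $\sum_{n=0}^\infty\alpha_nA^n$ converges and $f(A)=\sum_{n=0}^\infty\alpha_nA^n$. (ii) The map $f\mapsto f(A)$ is a homomorphism of unital complex algebras from the algebra of functions that are holomorphic on some open set containing $\sigma(A)$ to $\mathcal{A}$. (iii) (Spectral mapping theorem) If $f$ is holomorphic on an open set containing $\sigma(A)$, then $\sigma(f(A))=f(\sigma(A))$. (iv) If $f$ is holomorphic on an open set $\Omega\supseteq\sigma(A)$ and $g$ is holomorphic on an open set $E\supseteq f(\Omega)$, then $(g\circ f)(A)=g(f(A))$. -/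

import Mathlib

open scoped Polynomial

/-- A piecewise continuously differentiable loop in `ℂ`, parametrized by `[0, 1]`: for some
subdivision `0 = t 0 ≤ t 1 ≤ ⋯ ≤ t n = 1` it is of class `C¹` on each closed interval
`[t i, t (i + 1)]` (only the values on `[0, 1]` matter). -/
structure PwC1Loop where
  toFun : ℝ → ℂ
  continuousOn' : ContinuousOn toFun (Set.Icc 0 1)
  closed' : toFun 0 = toFun 1
  piecewise_C1' : ∃ (n : ℕ) (t : ℕ → ℝ), Monotone t ∧ t 0 = 0 ∧ t n = 1 ∧
    ∀ i < n, ContDiffOn ℝ 1 toFun (Set.Icc (t i) (t (i + 1)))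

/-- The trace of a loop. -/
def PwC1Loop.trace (γ : PwC1Loop) : Set ℂ := γ.toFun '' Set.Icc 0 1

/-- The line integral `∫_γ g(z) dz = ∫₀¹ γ'(t) g(γ(t)) dt` of a vector-valued function. -/
noncomputable def PwC1Loop.integral {E : Type*} [NormedAddCommGroup E] [NormedSpace ℂ E]
    (γ : PwC1Loop) (g : ℂ → E) : E :=
  ∫ t in (0 : ℝ)..1, deriv γ.toFun t • g (γ.toFun t)

/-- A cycle: a finite formal sum of loops, with integer coefficients. -/
abbrev LoopCycle : Type := PwC1Loop →₀ ℤ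

/-- The trace of a cycle: the union of the traces of its loops. -/
def LoopCycle.trace (Γ : LoopCycle) : Set ℂ := ⋃ γ ∈ Γ.support, γ.trace

/-- The integral along a cycle. -/
noncomputable def LoopCycle.integral {E : Type*} [NormedAddCommGroup E] [NormedSpace ℂ E]
    (Γ : LoopCycle) (g : ℂ → E) : E :=
  Γ.sum fun γ n => n • γ.integral g

/-- The index (winding number) of a cycle about a point `ζ` off its trace. -/
noncomputable def LoopCycle.index (Γ : LoopCycle) (ζ : ℂ) : ℂ :=
  (2 * Real.pi * Complex.I)⁻¹ * LoopCycle.integral Γ fun z => (z - ζ)⁻¹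

/-- The cycle `Γ` lies in `Ω \ K`, has index one about each point of `K`,
and index zero about each point outside `Ω`. -/
structure LoopCycle.Surrounds (Γ : LoopCycle) (K Ω : Set ℂ) : Prop where
  trace_subset : LoopCycle.trace Γ ⊆ Ω \ K
  index_eq_one : ∀ ζ ∈ K, LoopCycle.index Γ ζ = 1
  index_eq_zero : ∀ ζ ∉ Ω, LoopCycle.index Γ ζ = 0

/-- `f` is holomorphic near `K`, i.e. on some open set containing `K`. -/
def HolomorphicNear (K : Set ℂ) (f : ℂ → ℂ) : Prop :=
  ∃ Ω : Set ℂ, IsOpen Ω ∧ K ⊆ Ω ∧ DifferentiableOn ℂ f Ω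

/-- The algebra, under pointwise operations, of the functions that are holomorphic near `K`. -/
def holomorphicNearAlgebra (K : Set ℂ) : Subalgebra ℂ (ℂ → ℂ) where
  carrier := {f | HolomorphicNear K f}
  mul_mem' := by
    rintro f g ⟨U, hU, hKU, hf⟩ ⟨V, hV, hKV, hg⟩
    exact ⟨U ∩ V, hU.inter hV, Set.subset_inter hKU hKV,
      (hf.mono Set.inter_subset_left).mul (hg.mono Set.inter_subset_right)⟩
  add_mem' := by
    rintro f g ⟨U, hU, hKU, hf⟩ ⟨V, hV, hKV, hg⟩
    exact ⟨U ∩ V, hU.inter hV, Set.subset_inter hKU hKV,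
      (hf.mono Set.inter_subset_left).add (hg.mono Set.inter_subset_right)⟩
  algebraMap_mem' := fun c =>
    ⟨Set.univ, isOpen_univ, Set.subset_univ _, differentiableOn_const c⟩

section HolomorphicCalculus

variable {𝒜 : Type*} [NormedRing 𝒜] [NormedAlgebra ℂ 𝒜]

/-- `(1 / 2πi) ∫_Γ (z I - A)⁻¹ f(z) dz`; here `resolvent A z` is `(z I - A)⁻¹`. -/
noncomputable def cauchyIntegralAlong (A : 𝒜) (f : ℂ → ℂ) (Γ : LoopCycle) : 𝒜 :=
  (2 * Real.pi * Complex.I : ℂ)⁻¹ • LoopCycle.integral Γ fun z => f z • resolvent A z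

/-- `Γ` may be used to define `f(A)`: it surrounds `σ(A)` in an open set
on which `f` is holomorphic. -/
def IsAdmissibleCycle (A : 𝒜) (f : ℂ → ℂ) (Γ : LoopCycle) : Prop :=
  ∃ Ω : Set ℂ, IsOpen Ω ∧ spectrum ℂ A ⊆ Ω ∧ DifferentiableOn ℂ f Ω ∧
    LoopCycle.Surrounds Γ (spectrum ℂ A) Ω

open Classical in
/-- `f(A)`, the Cauchy integral along some admissible cycle (and `0` if there is none). -/
noncomputable def holCalc (A : 𝒜) (f : ℂ → ℂ) : 𝒜 :=
  if h : ∃ Γ, IsAdmissibleCycle A f Γ then cauchyIntegralAlong A f h.choose else 0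

end HolomorphicCalculus

/-! Everything rests on the homological form of Cauchy's theorem, proved here from a grid
construction. Given a compact `K` in an open `Ω`, take the squares of a fine grid that meet `K`.
Sides shared by two of them cancel, and the remaining sides close up to polygons that avoid `K`. The
resulting cycle surrounds `K` in `Ω`, and integrals along it of functions holomorphic in `Ω` vanish
square by square (`IsCompact.exists_surrounds_integral_eq_zero`).

Now let `Γ` be any cycle in an open `U` with index zero outside `U`. Its trace together with the
points of nonzero index form a compact subset `hull Γ` of `U`. Along a grid cycle around the hull,
Cauchy's formula represents a holomorphic `h` on `Γ`. Integrating over `Γ` and interchanging the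
integrals gives `∫_Γ h = 0`, because `Γ` has index zero about the points of the grid cycle.
Vector-valued functions are reduced to this case by continuous functionals.

Independence of the cycle is Cauchy's theorem for a difference of two cycles, in the complement of
the spectrum. The unit is computed on large circles, where the resolvent is close to `z⁻¹`.
Multiplicativity comes from two nested cycles, the resolvent identity and Fubini (`holCalc_mul`).
The spectral mapping theorem is then algebra: `w - f` is inverted when it has no zero on the
spectrum, and `f μ - f z` is divisible by `μ - z`. For compositions, the resolvent of `f(A)` is
written as an integral and Fubini is used again. Power series follow from uniform convergence of the
partial sums on a disc containing the spectrum. -/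

open Set MeasureTheory Filter Topology

/-! ### Integrals along a single loop -/

namespace PwC1Loop

variable {E : Type*} [NormedAddCommGroup E] [NormedSpace ℂ E] (γ : PwC1Loop)

theorem isCompact_trace : IsCompact γ.trace :=
  isCompact_Icc.image_of_continuousOn γ.continuousOn'

theorem mem_trace {t : ℝ} (ht : t ∈ Icc (0 : ℝ) 1) : γ.toFun t ∈ γ.trace :=
  mem_image_of_mem _ ht

theorem exists_countable_differentiableAt :
    ∃ s : Set ℝ, s.Countable ∧ ∀ x ∈ Ioo (0 : ℝ) 1 \ s, DifferentiableAt ℝ γ.toFun x := by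
  obtain ⟨n, t, ht, h0, h1, hC⟩ := γ.piecewise_C1'
  refine ⟨range t, countable_range t, fun x hx => ?_⟩
  have hx0 : t 0 ≤ x := h0 ▸ hx.1.1.le
  have hxn : x < t n := h1 ▸ hx.1.2
  have hex : ∃ k, x < t k := ⟨n, hxn⟩
  classical
  obtain ⟨k, hk⟩ : ∃ k, Nat.find hex = k + 1 :=
    Nat.exists_eq_succ_of_ne_zero fun h => absurd (h ▸ Nat.find_spec hex) (not_lt.2 hx0)
  have hlt : x < t (k + 1) := hk ▸ Nat.find_spec hex
  have hle : t k ≤ x := not_lt.1 (Nat.find_min hex (by omega))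
  have hne : t k ≠ x := fun h => hx.2 ⟨k, h⟩
  have hkn : k < n := by
    have := Nat.find_min' hex hxn
    omega
  exact ((hC k hkn).differentiableOn one_ne_zero).differentiableAt
    (Icc_mem_nhds (lt_of_le_of_ne hle hne) hlt)

/-- At a subdivision point `deriv` may be the default value `0`. On each piece it agrees in the
interior with `derivWithin`, which is continuous up to the end points. -/
theorem intervalIntegrable_deriv : IntervalIntegrable (deriv γ.toFun) volume 0 1 := by
  obtain ⟨n, t, ht, h0, h1, hC⟩ := γ.piecewise_C1'
  rw [← h0, ← h1]
  refine IntervalIntegrable.trans_iterate fun k hk => ?_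
  rcases (ht (Nat.le_succ k)).eq_or_lt with h | h
  · rw [h]
  have h1 : ContinuousOn (derivWithin γ.toFun (Icc (t k) (t (k + 1)))) (Icc (t k) (t (k + 1))) :=
    (hC k hk).continuousOn_derivWithin (uniqueDiffOn_Icc h) le_rfl
  have h2 : IntervalIntegrable (derivWithin γ.toFun (Icc (t k) (t (k + 1)))) volume
      (t k) (t (k + 1)) := h1.intervalIntegrable_of_Icc h.le
  refine h2.congr_uIoo ?_
  rw [uIoo_of_le h.le]
  exact fun x hx => derivWithin_of_mem_nhds (Icc_mem_nhds hx.1 hx.2)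

theorem continuousOn_comp {F : Type*} [TopologicalSpace F] {g : ℂ → F}
    (hg : ContinuousOn g γ.trace) :
    ContinuousOn (fun t => g (γ.toFun t)) (Icc 0 1) :=
  hg.comp γ.continuousOn' fun _ ht => γ.mem_trace ht

theorem intervalIntegrable_integrand {g : ℂ → E} (hg : ContinuousOn g γ.trace) :
    IntervalIntegrable (fun t => deriv γ.toFun t • g (γ.toFun t)) volume 0 1 :=
  γ.intervalIntegrable_deriv.smul_continuousOn
    (by rw [uIcc_of_le zero_le_one]; exact γ.continuousOn_comp hg)

theorem integral_congr {g h : ℂ → E} (hgh : EqOn g h γ.trace) : γ.integral g = γ.integral h :=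
  intervalIntegral.integral_congr fun t ht => by
    rw [uIcc_of_le zero_le_one] at ht
    simp only [hgh (γ.mem_trace ht)]

theorem integral_add {g h : ℂ → E} (hg : ContinuousOn g γ.trace) (hh : ContinuousOn h γ.trace) :
    γ.integral (fun z => g z + h z) = γ.integral g + γ.integral h := by
  simp only [integral, smul_add]
  exact intervalIntegral.integral_add (γ.intervalIntegrable_integrand hg)
    (γ.intervalIntegrable_integrand hh)

theorem integral_smul (c : ℂ) (g : ℂ → E) :
    γ.integral (fun z => c • g z) = c • γ.integral g := by
  simp only [integral, smul_comm _ c]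
  exact intervalIntegral.integral_smul c _

theorem map_integral {F : Type*} [NormedAddCommGroup F] [NormedSpace ℂ F] [CompleteSpace E]
    [CompleteSpace F]
    (L : E →L[ℂ] F) {g : ℂ → E} (hg : ContinuousOn g γ.trace) :
    L (γ.integral g) = γ.integral fun z => L (g z) := by
  simp only [integral, ← L.map_smul]
  exact (L.intervalIntegral_comp_comm (γ.intervalIntegrable_integrand hg)).symm

theorem integral_eq_zero_of_hasDerivAt [CompleteSpace E] {G g : ℂ → E}
    (hG : ∀ z ∈ γ.trace, HasDerivAt G (g z) z) (hg : ContinuousOn g γ.trace) :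
    γ.integral g = 0 := by
  obtain ⟨s, hs, hd⟩ := γ.exists_countable_differentiableAt
  have hGc : ContinuousOn G γ.trace := fun z hz => (hG z hz).continuousAt.continuousWithinAt
  have := MeasureTheory.integral_eq_of_hasDerivAt_off_countable
    (fun t => G (γ.toFun t)) (fun t => deriv γ.toFun t • g (γ.toFun t)) hs
    (a := 0) (b := 1) (by rw [uIcc_of_le zero_le_one]; exact γ.continuousOn_comp hGc)
    (fun x hx => by
      rw [min_eq_left zero_le_one, max_eq_right zero_le_one] at hx
      exact (hG _ (γ.mem_trace (Ioo_subset_Icc_self hx.1))).scomp x (hd x hx).hasDerivAt)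
    (γ.intervalIntegrable_integrand hg)
  rw [integral, this, γ.closed', sub_self]

theorem norm_integral_le {g : ℂ → E} {M : ℝ} (hg : ∀ z ∈ γ.trace, ‖g z‖ ≤ M) :
    ‖γ.integral g‖ ≤ (∫ t in (0 : ℝ)..1, ‖deriv γ.toFun t‖) * M := by
  rw [integral, ← intervalIntegral.integral_mul_const]
  refine intervalIntegral.norm_integral_le_of_norm_le zero_le_one
    (Eventually.of_forall fun t ht => ?_) (γ.intervalIntegrable_deriv.norm.mul_const M)
  rw [norm_smul]
  exact mul_le_mul_of_nonneg_left (hg _ (γ.mem_trace (Ioc_subset_Icc_self ht))) (norm_nonneg _)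

theorem integral_integral_swap [CompleteSpace E] (γ' : PwC1Loop) {G : ℂ → ℂ → E}
    (hG : ContinuousOn (Function.uncurry G) (γ.trace ×ˢ γ'.trace)) :
    γ.integral (fun z => γ'.integral (G z)) = γ'.integral fun w => γ.integral fun z => G z w := by
  have key : Integrable (Function.uncurry fun s t =>
      deriv γ.toFun s • deriv γ'.toFun t • G (γ.toFun s) (γ'.toFun t))
      ((volume.restrict (Ioc (0 : ℝ) 1)).prod (volume.restrict (Ioc (0 : ℝ) 1))) := by
    have h1 : Integrable (deriv γ.toFun) (volume.restrict (Ioc (0 : ℝ) 1)) :=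
      (intervalIntegrable_iff_integrableOn_Ioc_of_le zero_le_one).1 γ.intervalIntegrable_deriv
    have h2 : Integrable (deriv γ'.toFun) (volume.restrict (Ioc (0 : ℝ) 1)) :=
      (intervalIntegrable_iff_integrableOn_Ioc_of_le zero_le_one).1 γ'.intervalIntegrable_deriv
    -- The derivatives are merely integrable, so the integrand is treated as an integrable product
    -- times a bounded factor; the bound comes from compactness of the traces.
    have h3 := h1.mul_prod h2
    have hc : ContinuousOn (fun p : ℝ × ℝ => G (γ.toFun p.1) (γ'.toFun p.2))
        (Icc (0 : ℝ) 1 ×ˢ Icc (0 : ℝ) 1) :=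
      hG.comp ((γ.continuousOn'.comp continuousOn_fst fun p hp => hp.1).prodMk
        (γ'.continuousOn'.comp continuousOn_snd fun p hp => hp.2))
        fun p hp => ⟨γ.mem_trace hp.1, γ'.mem_trace hp.2⟩
    obtain ⟨C, hC⟩ := (isCompact_Icc.prod isCompact_Icc).exists_bound_of_continuousOn hc
    have hsub : (Ioc (0 : ℝ) 1 ×ˢ Ioc (0 : ℝ) 1) ⊆ Icc (0 : ℝ) 1 ×ˢ Icc (0 : ℝ) 1 :=
      prod_mono Ioc_subset_Icc_self Ioc_subset_Icc_self
    rw [Measure.prod_restrict] at h3 ⊢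
    have hm : MeasurableSet (Ioc (0 : ℝ) 1 ×ˢ Ioc (0 : ℝ) 1) :=
      measurableSet_Ioc.prod measurableSet_Ioc
    have h4 := h3.smul_bdd C (f := fun p : ℝ × ℝ => G (γ.toFun p.1) (γ'.toFun p.2))
      ((hc.mono hsub).aestronglyMeasurable hm)
      ((ae_restrict_iff' hm).2 (Eventually.of_forall fun p hp => hC p (hsub hp)))
    refine h4.congr (Eventually.of_forall fun p => ?_)
    simp [Function.uncurry, mul_smul]
  simp only [integral, intervalIntegral.integral_of_le zero_le_one, ← MeasureTheory.integral_smul]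
  rw [MeasureTheory.integral_integral_swap key]
  simp only [smul_comm (deriv γ.toFun _)]

theorem continuousOn_integral {X : Type*} [TopologicalSpace X] [FirstCountableTopology X]
    {s : Set X} {G : X → ℂ → E} (hG : ContinuousOn (Function.uncurry G) (s ×ˢ γ.trace))
    (hs : IsCompact s) : ContinuousOn (fun x => γ.integral (G x)) s := by
  obtain ⟨C, hC⟩ := (hs.prod γ.isCompact_trace).exists_bound_of_continuousOn hG
  have hGx : ∀ x ∈ s, ContinuousOn (G x) γ.trace := fun x hx =>
    hG.comp (by fun_prop : Continuous fun z : ℂ => (x, z)).continuousOn fun z hz => ⟨hx, hz⟩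
  intro x₀ hx₀
  refine intervalIntegral.continuousWithinAt_of_dominated_interval
    (bound := fun t => ‖deriv γ.toFun t‖ * C) ?_ ?_ (γ.intervalIntegrable_deriv.norm.mul_const C) ?_
  · filter_upwards [self_mem_nhdsWithin] with x hx
    exact (intervalIntegrable_iff.1 (γ.intervalIntegrable_integrand (hGx x hx))).aestronglyMeasurable
  · filter_upwards [self_mem_nhdsWithin] with x hx
    refine Eventually.of_forall fun t ht => ?_
    rw [uIoc_of_le zero_le_one] at ht
    rw [norm_smul]
    exact mul_le_mul_of_nonneg_left (hC (x, _) ⟨hx, γ.mem_trace (Ioc_subset_Icc_self ht)⟩)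
      (norm_nonneg _)
  · refine Eventually.of_forall fun t ht => ContinuousWithinAt.const_smul ?_ _
    rw [uIoc_of_le zero_le_one] at ht
    have h := γ.mem_trace (Ioc_subset_Icc_self ht)
    exact (hG.comp (by fun_prop : Continuous fun x : X => (x, γ.toFun t)).continuousOn
      fun x hx => ⟨hx, h⟩) x₀ hx₀

theorem integral_finset_sum_zsmul {ι : Type*} (s : Finset ι) (m : ι → ℤ) {g : ι → ℂ → E}
    (hg : ∀ i ∈ s, ContinuousOn (g i) γ.trace) :
    γ.integral (fun z => ∑ i ∈ s, m i • g i z) = ∑ i ∈ s, m i • γ.integral (g i) := by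
  classical
  simp only [← Int.cast_smul_eq_zsmul ℂ]
  induction s using Finset.induction_on with
  | empty => simp [integral]
  | insert a s ha ih =>
    simp only [Finset.sum_insert ha]
    rw [γ.integral_add (g := fun z => (m a : ℂ) • g a z) (h := fun z => ∑ i ∈ s, (m i : ℂ) • g i z)
      ((hg a (Finset.mem_insert_self a s)).const_smul _) (continuousOn_finsetSum s fun i hi =>
        (hg i (Finset.mem_insert_of_mem hi)).const_smul _),
      ih fun i hi => hg i (Finset.mem_insert_of_mem hi), γ.integral_smul]

end PwC1Loop

/-! ### Integrals along cycles, the index and the hull -/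

namespace LoopCycle

variable {E : Type*} [NormedAddCommGroup E] [NormedSpace ℂ E] (Γ : LoopCycle)

theorem trace_subset_of_mem {γ : PwC1Loop} (hγ : γ ∈ Γ.support) : γ.trace ⊆ LoopCycle.trace Γ :=
  subset_biUnion_of_mem (u := fun γ : PwC1Loop => γ.trace) hγ

theorem isCompact_trace : IsCompact (LoopCycle.trace Γ) :=
  Γ.support.finite_toSet.isCompact_biUnion fun γ _ => γ.isCompact_trace

theorem isClosed_trace : IsClosed (LoopCycle.trace Γ) := (isCompact_trace Γ).isClosed

theorem trace_add_subset (Γ₁ Γ₂ : LoopCycle) :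
    LoopCycle.trace (Γ₁ + Γ₂) ⊆ LoopCycle.trace Γ₁ ∪ LoopCycle.trace Γ₂ := by
  classical
  intro z hz
  obtain ⟨γ, hγ, hz⟩ := mem_iUnion₂.1 hz
  rcases Finset.mem_union.1 (Finsupp.support_add hγ) with h | h
  · exact Or.inl (trace_subset_of_mem _ h hz)
  · exact Or.inr (trace_subset_of_mem _ h hz)

theorem trace_sub_subset (Γ₁ Γ₂ : LoopCycle) :
    LoopCycle.trace (Γ₁ - Γ₂) ⊆ LoopCycle.trace Γ₁ ∪ LoopCycle.trace Γ₂ := by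
  classical
  intro z hz
  obtain ⟨γ, hγ, hz⟩ := mem_iUnion₂.1 hz
  rcases Finset.mem_union.1 (Finsupp.support_sub hγ) with h | h
  · exact Or.inl (trace_subset_of_mem _ h hz)
  · exact Or.inr (trace_subset_of_mem _ h hz)

theorem trace_zero : LoopCycle.trace 0 = ∅ := by
  simp [LoopCycle.trace]

theorem trace_single (γ : PwC1Loop) : LoopCycle.trace (Finsupp.single γ 1) = γ.trace := by
  simp [LoopCycle.trace]

theorem integral_zero_cycle (g : ℂ → E) : LoopCycle.integral 0 g = 0 := Finsupp.sum_zero_index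

theorem integral_single (γ : PwC1Loop) (g : ℂ → E) :
    LoopCycle.integral (Finsupp.single γ 1) g = γ.integral g := by
  simp [LoopCycle.integral]

theorem integral_add_cycle (Γ₁ Γ₂ : LoopCycle) (g : ℂ → E) :
    LoopCycle.integral (Γ₁ + Γ₂) g = LoopCycle.integral Γ₁ g + LoopCycle.integral Γ₂ g :=
  Finsupp.sum_add_index' (fun _ => zero_smul _ _) fun _ _ _ => add_smul _ _ _

theorem integral_sub_cycle (Γ₁ Γ₂ : LoopCycle) (g : ℂ → E) :
    LoopCycle.integral (Γ₁ - Γ₂) g = LoopCycle.integral Γ₁ g - LoopCycle.integral Γ₂ g :=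
  Finsupp.sum_sub_index fun _ _ _ => sub_smul _ _ _

theorem integral_congr {g h : ℂ → E} (hgh : EqOn g h (LoopCycle.trace Γ)) :
    LoopCycle.integral Γ g = LoopCycle.integral Γ h :=
  Finset.sum_congr rfl fun γ hγ => by
    simp only [γ.integral_congr (hgh.mono (trace_subset_of_mem Γ hγ))]

theorem integral_add {g h : ℂ → E} (hg : ContinuousOn g (LoopCycle.trace Γ))
    (hh : ContinuousOn h (LoopCycle.trace Γ)) :
    LoopCycle.integral Γ (fun z => g z + h z) =
      LoopCycle.integral Γ g + LoopCycle.integral Γ h := by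
  simp only [LoopCycle.integral, Finsupp.sum, ← Finset.sum_add_distrib, ← smul_add]
  refine Finset.sum_congr rfl fun γ hγ => ?_
  rw [γ.integral_add (hg.mono (trace_subset_of_mem Γ hγ)) (hh.mono (trace_subset_of_mem Γ hγ))]

theorem integral_smul (c : ℂ) (g : ℂ → E) :
    LoopCycle.integral Γ (fun z => c • g z) = c • LoopCycle.integral Γ g := by
  simp only [LoopCycle.integral, Finsupp.sum, Finset.smul_sum, PwC1Loop.integral_smul]
  exact Finset.sum_congr rfl fun γ _ => smul_comm _ _ _

theorem integral_sub {g h : ℂ → E} (hg : ContinuousOn g (LoopCycle.trace Γ))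
    (hh : ContinuousOn h (LoopCycle.trace Γ)) :
    LoopCycle.integral Γ (fun z => g z - h z) =
      LoopCycle.integral Γ g - LoopCycle.integral Γ h := by
  have := integral_add Γ (h := fun z => (-1 : ℂ) • h z) hg (hh.const_smul (-1 : ℂ))
  rw [integral_smul] at this
  simpa [sub_eq_add_neg] using this

theorem map_integral {F : Type*} [NormedAddCommGroup F] [NormedSpace ℂ F] [CompleteSpace E]
    [CompleteSpace F] (L : E →L[ℂ] F) {g : ℂ → E} (hg : ContinuousOn g (LoopCycle.trace Γ)) :
    L (LoopCycle.integral Γ g) = LoopCycle.integral Γ fun z => L (g z) := by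
  simp only [LoopCycle.integral, Finsupp.sum, map_sum, map_zsmul]
  refine Finset.sum_congr rfl fun γ hγ => ?_
  rw [γ.map_integral L (hg.mono (trace_subset_of_mem Γ hγ))]

theorem integral_eq_zero_of_hasDerivAt [CompleteSpace E] {G g : ℂ → E}
    (hG : ∀ z ∈ LoopCycle.trace Γ, HasDerivAt G (g z) z)
    (hg : ContinuousOn g (LoopCycle.trace Γ)) : LoopCycle.integral Γ g = 0 :=
  Finset.sum_eq_zero fun γ hγ => by
    simp only [γ.integral_eq_zero_of_hasDerivAt
      (fun z hz => hG z (trace_subset_of_mem Γ hγ hz)) (hg.mono (trace_subset_of_mem Γ hγ)),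
      smul_zero]

theorem exists_norm_integral_le : ∃ C : ℝ, 0 ≤ C ∧ ∀ (g : ℂ → E) (M : ℝ),
    (∀ z ∈ LoopCycle.trace Γ, ‖g z‖ ≤ M) → ‖LoopCycle.integral Γ g‖ ≤ C * M := by
  -- The constant is the length of the cycle, counted with multiplicity; it does not depend on `g`.
  refine ⟨Γ.sum fun γ n => ‖n‖ * ∫ t in (0 : ℝ)..1, ‖deriv γ.toFun t‖,
    Finset.sum_nonneg fun γ _ => mul_nonneg (norm_nonneg _)
      (intervalIntegral.integral_nonneg zero_le_one fun _ _ => norm_nonneg _), fun g M hM => ?_⟩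
  simp only [LoopCycle.integral, Finsupp.sum, Finset.sum_mul, mul_assoc]
  refine norm_sum_le_of_le _ fun γ hγ => (norm_zsmul_le _ _).trans ?_
  gcongr
  exact γ.norm_integral_le fun z hz => hM z (trace_subset_of_mem Γ hγ hz)

theorem integral_integral_swap [CompleteSpace E] (Γ' : LoopCycle) {G : ℂ → ℂ → E}
    (hG : ContinuousOn (Function.uncurry G) (LoopCycle.trace Γ ×ˢ LoopCycle.trace Γ')) :
    LoopCycle.integral Γ (fun z => LoopCycle.integral Γ' (G z)) =
      LoopCycle.integral Γ' fun w => LoopCycle.integral Γ fun z => G z w := by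
  have h1 : ∀ γ ∈ Γ.support, γ.integral (fun z => LoopCycle.integral Γ' (G z)) =
      ∑ γ' ∈ Γ'.support, Γ' γ' • γ.integral fun z => γ'.integral (G z) := fun γ hγ =>
    γ.integral_finset_sum_zsmul _ _ fun γ' hγ' => γ'.continuousOn_integral
      (hG.mono (prod_mono (trace_subset_of_mem Γ hγ) (trace_subset_of_mem Γ' hγ')))
      γ.isCompact_trace
  have h2 : ∀ γ' ∈ Γ'.support, γ'.integral (fun w => LoopCycle.integral Γ fun z => G z w) =
      ∑ γ ∈ Γ.support, Γ γ • γ'.integral fun w => γ.integral fun z => G z w := fun γ' hγ' =>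
    γ'.integral_finset_sum_zsmul _ _ fun γ hγ => γ.continuousOn_integral (G := fun w z => G z w)
      (hG.comp continuous_swap.continuousOn
        fun p hp => ⟨trace_subset_of_mem Γ hγ hp.2, trace_subset_of_mem Γ' hγ' hp.1⟩) γ'.isCompact_trace
  rw [LoopCycle.integral, LoopCycle.integral, Finsupp.sum, Finsupp.sum,
    Finset.sum_congr rfl fun γ hγ => congrArg (Γ γ • ·) (h1 γ hγ),
    Finset.sum_congr rfl fun γ' hγ' => congrArg (Γ' γ' • ·) (h2 γ' hγ')]
  simp only [Finset.smul_sum]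
  rw [Finset.sum_comm]
  refine Finset.sum_congr rfl fun γ' hγ' => Finset.sum_congr rfl fun γ hγ => ?_
  rw [smul_comm, γ.integral_integral_swap γ'
    (hG.mono (prod_mono (trace_subset_of_mem Γ hγ) (trace_subset_of_mem Γ' hγ')))]

/-- Points joined by a segment off the trace have the same index. -/
theorem integral_inv_sub_eq_of_segment {z₀ z₁ : ℂ}
    (h : Disjoint (segment ℝ z₀ z₁) (LoopCycle.trace Γ)) :
    LoopCycle.integral Γ (fun w => (w - z₀)⁻¹) = LoopCycle.integral Γ fun w => (w - z₁)⁻¹ := by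
  have h0 : ∀ w ∈ LoopCycle.trace Γ, w - z₀ ≠ 0 := fun w hw h' =>
    h.le_bot ⟨sub_eq_zero.1 h' ▸ left_mem_segment ℝ z₀ z₁, hw⟩
  have h1 : ∀ w ∈ LoopCycle.trace Γ, w - z₁ ≠ 0 := fun w hw h' =>
    h.le_bot ⟨sub_eq_zero.1 h' ▸ right_mem_segment ℝ z₀ z₁, hw⟩
  have hc : ∀ z : ℂ, (∀ w ∈ LoopCycle.trace Γ, w - z ≠ 0) →
      ContinuousOn (fun w => (w - z)⁻¹) (LoopCycle.trace Γ) := fun z hz =>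
    (continuousOn_id.sub continuousOn_const).inv₀ hz
  rw [← sub_eq_zero, ← integral_sub Γ (hc z₀ h0) (hc z₁ h1)]
  -- The quotient `(w - z₀) / (w - z₁)` is a nonpositive real only for `w` on the segment, so off
  -- the segment its principal logarithm is a primitive of the difference of the two integrands.
  refine integral_eq_zero_of_hasDerivAt Γ (G := fun w => Complex.log ((w - z₀) / (w - z₁)))
    (fun w hw => ?_) ((hc z₀ h0).sub (hc z₁ h1))
  have hs : (w - z₀) / (w - z₁) ∈ Complex.slitPlane := by
    by_contra hs
    rw [Complex.mem_slitPlane_iff_not_le_zero, not_not] at hs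
    set r := (w - z₀) / (w - z₁) with hr
    obtain ⟨hre, him⟩ := Complex.le_def.1 hs
    have hr' : r = ((r.re : ℝ) : ℂ) := Complex.ext rfl (by simpa using him)
    have hre : r.re ≤ 0 := hre
    have hrw : w - z₀ = r * (w - z₁) := by rw [hr, div_mul_cancel₀ _ (h1 w hw)]
    refine h.le_bot ⟨?_, hw⟩
    have hpos : (1 - r.re : ℝ) ≠ 0 := by linarith
    have hposc : (1 - r.re : ℂ) ≠ 0 := by exact_mod_cast hpos
    -- Solving `w - z₀ = r (w - z₁)` for `w` gives `w = (z₀ - r z₁) / (1 - r)`, a convex combination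
    -- since `r ≤ 0`.
    refine ⟨1 / (1 - r.re), -r.re / (1 - r.re), by apply div_nonneg <;> linarith,
      by apply div_nonneg <;> linarith, by field_simp; ring, ?_⟩
    rw [hr'] at hrw
    simp only [Complex.real_smul]
    push_cast
    field_simp
    linear_combination -hrw
  have := (((hasDerivAt_id w).sub_const z₀).div ((hasDerivAt_id w).sub_const z₁)
    (h1 w hw)).clog hs
  refine this.congr_deriv ?_
  have := h0 w hw
  have := h1 w hw
  change (1 * (w - z₁) - (w - z₀) * 1) / (w - z₁) ^ 2 / ((w - z₀) / (w - z₁)) =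
    (w - z₀)⁻¹ - (w - z₁)⁻¹
  field_simp

theorem index_eq_of_segment {z₀ z₁ : ℂ}
    (h : Disjoint (segment ℝ z₀ z₁) (LoopCycle.trace Γ)) :
    LoopCycle.index Γ z₀ = LoopCycle.index Γ z₁ := by
  rw [index, index, integral_inv_sub_eq_of_segment Γ h]

theorem eventually_index_eq {z : ℂ} (hz : z ∉ LoopCycle.trace Γ) :
    ∀ᶠ w in 𝓝 z, w ∉ LoopCycle.trace Γ ∧ LoopCycle.index Γ w = LoopCycle.index Γ z := by
  obtain ⟨r, hr, hb⟩ := Metric.isOpen_iff.1 (isClosed_trace Γ).isOpen_compl z hz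
  filter_upwards [Metric.ball_mem_nhds z hr] with w hw
  refine ⟨hb hw, (index_eq_of_segment Γ (disjoint_left.2 fun x hx hx' => ?_)).symm⟩
  exact hb ((convex_ball z r).segment_subset (Metric.mem_ball_self hr) hw hx) hx'

/-- If `z` is farther from `0` than the whole trace, then `|w / z| < 1` on the trace and `log (1 - w
/ z)` is a primitive of `(w - z)⁻¹` there. -/
theorem exists_index_eq_zero :
    ∃ R : ℝ, ∀ z : ℂ, R < ‖z‖ → z ∉ LoopCycle.trace Γ ∧ LoopCycle.index Γ z = 0 := by
  obtain ⟨R, hR⟩ := (isCompact_trace Γ).isBounded.exists_norm_le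
  refine ⟨max R 0, fun z hz => ?_⟩
  have hlt : ∀ w ∈ LoopCycle.trace Γ, ‖w‖ < ‖z‖ := fun w hw =>
    (hR w hw).trans_lt ((le_max_left _ _).trans_lt hz)
  have hz0 : z ≠ 0 := norm_pos_iff.1 ((le_max_right _ _).trans_lt hz)
  have hne : ∀ w ∈ LoopCycle.trace Γ, w - z ≠ 0 := fun w hw h => by
    have := hlt w hw
    rw [sub_eq_zero.1 h] at this
    exact lt_irrefl _ this
  refine ⟨fun h => hne z h (sub_self z), ?_⟩
  rw [index, integral_eq_zero_of_hasDerivAt Γ (g := fun w => (w - z)⁻¹)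
    (G := fun w => Complex.log (1 + -(w / z))) (fun w hw => ?_) ((continuousOn_id.sub continuousOn_const).inv₀ hne), mul_zero]
  have hs : 1 + -(w / z) ∈ Complex.slitPlane := by
    refine Complex.mem_slitPlane_of_norm_lt_one ?_
    rw [norm_neg, norm_div, div_lt_one (norm_pos_iff.2 hz0)]
    exact hlt w hw
  have := ((((hasDerivAt_id w).div_const z).neg).const_add 1).clog hs
  refine this.congr_deriv ?_
  have h1 := hne w hw
  have h2 : z - w ≠ 0 := fun h => h1 (by rw [← neg_sub, h, neg_zero])
  have h3 : 1 + -(w / z) ≠ 0 := Complex.slitPlane_ne_zero hs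
  change -(1 / z) / (1 + -(w / z)) = (w - z)⁻¹
  rw [eq_comm, eq_div_iff h3]
  field_simp
  ring

/-- The trace of a cycle together with the points of nonzero index. -/
def hull : Set ℂ := LoopCycle.trace Γ ∪ {z | LoopCycle.index Γ z ≠ 0}

/-- The index is locally constant off the trace, so the hull is closed; it vanishes far out, so the
hull is bounded. A second cycle around the hull runs where the first has index zero. -/
theorem isCompact_hull : IsCompact (hull Γ) := by
  refine Metric.isCompact_of_isClosed_isBounded ?_ ?_
  · rw [← isOpen_compl_iff, isOpen_iff_mem_nhds]
    intro z hz
    have hz1 : z ∉ LoopCycle.trace Γ := fun h => hz (Or.inl h)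
    have hz2 : LoopCycle.index Γ z = 0 := by
      by_contra h
      exact hz (Or.inr h)
    filter_upwards [eventually_index_eq Γ hz1] with w hw
    rintro (h | h)
    · exact hw.1 h
    · exact h (hw.2.trans hz2)
  · obtain ⟨R, hR⟩ := exists_index_eq_zero Γ
    refine isBounded_iff_forall_norm_le.2 ⟨R, fun z hz => ?_⟩
    by_contra! h
    rcases hz with hz | hz
    · exact (hR z h).1 hz
    · exact hz (hR z h).2

end LoopCycle
-- Segments and closed polygons
/-- The integral of `g` along the segment from `a` to `b`. -/
noncomputable def segmentIntegral (a b : ℂ) (g : ℂ → ℂ) : ℂ :=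
  ∫ t in (0 : ℝ)..1, (b - a) * g (a + t * (b - a))

theorem segmentIntegral_symm (a b : ℂ) (g : ℂ → ℂ) :
    segmentIntegral b a g = -segmentIntegral a b g := by
  have h := intervalIntegral.integral_comp_sub_left
    (fun t : ℝ => (a - b) * g (b + t * (a - b))) (1 : ℝ) (a := 0) (b := 1)
  rw [sub_self, sub_zero] at h
  rw [segmentIntegral, ← h, segmentIntegral, ← intervalIntegral.integral_neg]
  congr 1
  ext t
  rw [show b + ((1 - t : ℝ) : ℂ) * (a - b) = a + t * (b - a) by push_cast; ring]
  ring

theorem add_mul_sub_mem_segment {a b : ℂ} {t : ℝ} (ht : t ∈ Icc (0 : ℝ) 1) :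
    a + t * (b - a) ∈ segment ℝ a b := by
  rw [segment_eq_image']
  exact ⟨t, ht, by simp⟩

theorem segmentIntegral_eq_sub {a b : ℂ} {G g : ℂ → ℂ}
    (hG : ∀ z ∈ segment ℝ a b, HasDerivAt G (g z) z) (hg : ContinuousOn g (segment ℝ a b)) :
    segmentIntegral a b g = G b - G a := by
  have hd : ∀ t : ℝ, HasDerivAt (fun t : ℝ => a + t * (b - a)) (b - a) t := fun t => by
    simpa using ((Complex.ofRealCLM.hasDerivAt (x := t)).mul_const (b - a)).const_add a
  have hc : ContinuousOn (fun t : ℝ => (b - a) * g (a + t * (b - a))) (uIcc 0 1) := by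
    rw [uIcc_of_le zero_le_one]
    exact continuousOn_const.mul (hg.comp (by fun_prop) fun t ht => add_mul_sub_mem_segment ht)
  rw [segmentIntegral, intervalIntegral.integral_eq_sub_of_hasDerivAt
    (f := fun t : ℝ => G (a + t * (b - a))) (fun t ht => ?_) hc.intervalIntegrable]
  · simp
  · rw [uIcc_of_le zero_le_one] at ht
    exact (hG _ (add_mul_sub_mem_segment ht)).scomp t (hd t)

section Polygon

variable (p : ℕ → ℂ) (n : ℕ)

/-- The polygonal path with vertices `p 0, …, p n`, parametrized by `[0, 1]`. -/
noncomputable def polygonalPath (t : ℝ) : ℂ :=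
  -- The `i`-th summand moves only while `n * t` runs from `i` to `i + 1`; writing the path as a sum
  -- of clamped increments makes continuity immediate.
  p 0 + ∑ i ∈ Finset.range n, ((max 0 (min 1 (n * t - i)) : ℝ) : ℂ) * (p (i + 1) - p i)

theorem continuous_polygonalPath : Continuous (polygonalPath p n) := by
  unfold polygonalPath
  fun_prop

variable {n}

theorem polygonalPath_eq {j : ℕ} (hj : j < n) {t : ℝ} (h1 : j ≤ n * t) (h2 : n * t ≤ j + 1) :
    polygonalPath p n t = p j + ((n * t - j : ℝ) : ℂ) * (p (j + 1) - p j) := by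
  rw [polygonalPath, ← Finset.sum_range_add_sum_Ico _ (Nat.succ_le_of_lt hj),
    Finset.sum_range_succ]
  have e1 : ∑ i ∈ Finset.range j,
      ((max 0 (min 1 (n * t - i)) : ℝ) : ℂ) * (p (i + 1) - p i) = p j - p 0 := by
    rw [← Finset.sum_range_sub]
    refine Finset.sum_congr rfl fun i hi => ?_
    have : (i : ℝ) + 1 ≤ j := by exact_mod_cast Finset.mem_range.1 hi
    rw [min_eq_left (by linarith), max_eq_right zero_le_one, Complex.ofReal_one, one_mul]
  have e2 : ∑ i ∈ Finset.Ico (j + 1) n,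
      ((max 0 (min 1 (n * t - i)) : ℝ) : ℂ) * (p (i + 1) - p i) = 0 := by
    refine Finset.sum_eq_zero fun i hi => ?_
    have : (j : ℝ) + 1 ≤ i := by exact_mod_cast (Finset.mem_Ico.1 hi).1
    rw [min_eq_right (by linarith), max_eq_left (by linarith), Complex.ofReal_zero, zero_mul]
  rw [e1, e2, min_eq_right (by linarith), max_eq_right (by linarith)]
  ring

variable (n) in
theorem polygonalPath_zero : polygonalPath p n 0 = p 0 := by
  rw [polygonalPath, Finset.sum_eq_zero, add_zero]
  intro i hi
  rw [mul_zero, zero_sub, min_eq_right (by linarith [Nat.cast_nonneg (α := ℝ) i]),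
    max_eq_left (by linarith [Nat.cast_nonneg (α := ℝ) i]), Complex.ofReal_zero, zero_mul]

theorem polygonalPath_one (hn : 0 < n) : polygonalPath p n 1 = p n := by
  obtain ⟨m, rfl⟩ := Nat.exists_eq_succ_of_ne_zero hn.ne'
  rw [polygonalPath_eq p (Nat.lt_succ_self m) (by push_cast; linarith) (by push_cast; linarith)]
  push_cast
  ring

theorem mul_mem_Icc_of_mem_Icc_div (hn : 0 < n) {i : ℕ} {t : ℝ}
    (ht : t ∈ Icc ((i : ℝ) / n) ((i + 1 : ℕ) / n)) : (i : ℝ) ≤ n * t ∧ n * t ≤ (i : ℝ) + 1 := by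
  have hn' : (0 : ℝ) < n := Nat.cast_pos.2 hn
  have h1 := (div_le_iff₀ hn').1 ht.1
  have h2 := (le_div_iff₀ hn').1 ht.2
  push_cast at h2
  exact ⟨by linarith, by linarith⟩

/-- The closed polygon with vertices `p 0, …, p n = p 0`. -/
noncomputable def polygon (hn : 0 < n) (hp : p n = p 0) : PwC1Loop where
  toFun := polygonalPath p n
  continuousOn' := (continuous_polygonalPath p n).continuousOn
  closed' := by rw [polygonalPath_zero, polygonalPath_one p hn, hp]
  piecewise_C1' := by
    have hn' : (0 : ℝ) < n := Nat.cast_pos.2 hn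
    refine ⟨n, fun i => i / n, fun i j hij => ?_, by simp, div_self hn'.ne', fun i hi => ?_⟩
    · have : (i : ℝ) ≤ j := Nat.cast_le.2 hij
      simp only
      gcongr
    · have hC : ContDiff ℝ 1 fun t : ℝ => p i + ((n * t - i : ℝ) : ℂ) * (p (i + 1) - p i) :=
        contDiff_const.add ((Complex.ofRealCLM.contDiff.comp
          ((contDiff_const.mul contDiff_id).sub contDiff_const)).mul contDiff_const)
      refine hC.contDiffOn.congr fun t ht => ?_
      obtain ⟨h1, h2⟩ := mul_mem_Icc_of_mem_Icc_div hn ht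
      exact polygonalPath_eq p hi h1 h2

theorem trace_polygon_subset (hn : 0 < n) (hp : p n = p 0) :
    (polygon p hn hp).trace ⊆ ⋃ i < n, segment ℝ (p i) (p (i + 1)) := by
  have hn' : (0 : ℝ) < n := Nat.cast_pos.2 hn
  rintro _ ⟨t, ht, rfl⟩
  obtain ⟨i, hi, h1, h2⟩ : ∃ i < n, (i : ℝ) ≤ n * t ∧ n * t ≤ i + 1 := by
    rcases eq_or_lt_of_le ht.2 with rfl | h
    -- At `t = 1` the floor of `n * t` would be `n`, one past the last segment.
    · exact ⟨n - 1, by omega, by rw [Nat.cast_pred hn]; linarith, by rw [Nat.cast_pred hn]; linarith⟩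
    · have h0 : 0 ≤ n * t := mul_nonneg hn'.le ht.1
      exact ⟨⌊n * t⌋₊, (Nat.floor_lt h0).2 (by nlinarith), Nat.floor_le h0,
        (Nat.lt_floor_add_one _).le⟩
  refine mem_iUnion₂.2 ⟨i, hi, ?_⟩
  change polygonalPath p n t ∈ _
  rw [polygonalPath_eq p hi h1 h2]
  exact add_mul_sub_mem_segment ⟨by linarith, by linarith⟩

theorem integral_polygon (hn : 0 < n) (hp : p n = p 0) {g : ℂ → ℂ}
    (hg : ContinuousOn g (⋃ i < n, segment ℝ (p i) (p (i + 1)))) :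
    (polygon p hn hp).integral g = ∑ i ∈ Finset.range n, segmentIntegral (p i) (p (i + 1)) g := by
  have hn' : (0 : ℝ) < n := Nat.cast_pos.2 hn
  have hle : ∀ i : ℕ, (i : ℝ) / n ≤ (i + 1 : ℕ) / n := fun i => by
    push_cast
    gcongr
    linarith
  have hint := (polygon p hn hp).intervalIntegrable_integrand
    (hg.mono (trace_polygon_subset p hn hp))
  rw [PwC1Loop.integral]
  have hsum := intervalIntegral.sum_integral_adjacent_intervals (n := n) (a := fun i => (i : ℝ) / n)
    (μ := volume)
    (f := fun t => deriv (polygon p hn hp).toFun t • g ((polygon p hn hp).toFun t)) fun k hk => by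
      refine hint.mono_set ?_
      rw [uIcc_of_le (hle k), uIcc_of_le zero_le_one]
      refine Icc_subset_Icc (by positivity) ((div_le_one hn').2 ?_)
      exact_mod_cast hk
  simp only [Nat.cast_zero, zero_div, div_self hn'.ne'] at hsum
  rw [← hsum]
  refine Finset.sum_congr rfl fun i hi => ?_
  have hi := Finset.mem_range.1 hi
  have e1 : ∫ t in (i : ℝ) / n..(i + 1 : ℕ) / n,
      deriv (polygon p hn hp).toFun t • g ((polygon p hn hp).toFun t) =
      ∫ t in (i : ℝ) / n..(i + 1 : ℕ) / n, (n : ℝ) • ((p (i + 1) - p i) *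
        g (p i + ((n * t - i : ℝ) : ℂ) * (p (i + 1) - p i))) := by
    refine intervalIntegral.integral_congr_Ioo_of_le (hle i) fun t ht => ?_
    obtain ⟨h1, h2⟩ := mul_mem_Icc_of_mem_Icc_div hn (Ioo_subset_Icc_self ht)
    have hev : (polygon p hn hp).toFun =ᶠ[𝓝 t]
        fun t : ℝ => p i + ((n * t - i : ℝ) : ℂ) * (p (i + 1) - p i) := by
      filter_upwards [Icc_mem_nhds ht.1 ht.2] with x hx
      obtain ⟨h1, h2⟩ := mul_mem_Icc_of_mem_Icc_div hn hx
      exact polygonalPath_eq p hi h1 h2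
    have hd : HasDerivAt (fun t : ℝ => p i + ((n * t - i : ℝ) : ℂ) * (p (i + 1) - p i))
        ((n : ℂ) * (p (i + 1) - p i)) t := by
      have := (((hasDerivAt_id t).const_mul (n : ℝ)).sub_const (i : ℝ)).ofReal_comp
      simpa using (this.mul_const (p (i + 1) - p i)).const_add (p i)
    rw [hev.deriv_eq, hd.deriv, hev.eq_of_nhds, smul_eq_mul, Complex.real_smul]
    push_cast
    ring
  rw [e1, intervalIntegral.integral_smul, intervalIntegral.smul_integral_comp_mul_sub
    (fun x : ℝ => (p (i + 1) - p i) * g (p i + (x : ℂ) * (p (i + 1) - p i))),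
    mul_div_cancel₀ _ hn'.ne', mul_div_cancel₀ _ hn'.ne', segmentIntegral]
  simp

end Polygon
-- The successor `σ x` starts where the segment of `x` ends, so each orbit of `σ` runs through a
-- closed polygon. The induction removes one orbit at a time from the invariant set `S`.
theorem Equiv.Perm.exists_loopCycle {T : Type*} [Finite T] (σ : Equiv.Perm T) (a b : T → ℂ)
    (hab : ∀ x, a (σ x) = b x) (S : Finset T) (hS : ∀ x ∈ S, σ x ∈ S) :
    ∃ Γ : LoopCycle, LoopCycle.trace Γ ⊆ ⋃ x ∈ S, segment ℝ (a x) (b x) ∧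
      ∀ g : ℂ → ℂ, ContinuousOn g (⋃ x ∈ S, segment ℝ (a x) (b x)) →
        LoopCycle.integral Γ g = ∑ x ∈ S, segmentIntegral (a x) (b x) g := by
  classical
  induction S using Finset.strongInduction with
  | H S ih =>
    rcases S.eq_empty_or_nonempty with rfl | ⟨e, he⟩
    · exact ⟨0, by simp [LoopCycle.trace_zero], fun g _ => by
        rw [LoopCycle.integral_zero_cycle, Finset.sum_empty]⟩
    set n := Function.minimalPeriod σ e with hn
    have hn0 : 0 < n :=
      Function.minimalPeriod_pos_of_mem_periodicPts (σ.injective.mem_periodicPts e)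
    have hper : σ^[n] e = e := Function.iterate_minimalPeriod
    have hmem : ∀ i, σ^[i] e ∈ S := fun i => by
      induction i with
      | zero => exact he
      | succ i ih => rw [Function.iterate_succ_apply']; exact hS _ ih
    set O : Finset T := (Finset.range n).image fun i => σ^[i] e with hO
    have hOS : O ⊆ S := Finset.image_subset_iff.2 fun i _ => hmem i
    have heO : e ∈ O := Finset.mem_image.2 ⟨0, Finset.mem_range.2 hn0, rfl⟩
    have hinv : ∀ x ∈ S \ O, σ x ∈ S \ O := fun x hx => by
      rw [Finset.mem_sdiff] at hx ⊢
      refine ⟨hS x hx.1, fun h => hx.2 ?_⟩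
      obtain ⟨i, hi, hix⟩ := Finset.mem_image.1 h
      rw [Finset.mem_range] at hi
      -- The predecessor of `e` in its orbit is the iterate with index `n - 1`.
      rcases i with _ | i
      · refine Finset.mem_image.2 ⟨n - 1, Finset.mem_range.2 (by omega), σ.injective ?_⟩
        rw [← Function.iterate_succ_apply' σ, Nat.succ_eq_add_one, Nat.sub_add_cancel hn0, hper]
        exact hix
      · refine Finset.mem_image.2 ⟨i, Finset.mem_range.2 (by omega), σ.injective ?_⟩
        rw [← Function.iterate_succ_apply' σ]
        exact hix
    obtain ⟨Γ, hΓt, hΓi⟩ := ih (S \ O) (Finset.sdiff_ssubset hOS ⟨e, heO⟩) hinv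
    set p : ℕ → ℂ := fun i => a (σ^[i] e) with hp
    have hpn : p n = p 0 := by simp only [hp, hper, Function.iterate_zero, id]
    have hps : ∀ i, p (i + 1) = b (σ^[i] e) := fun i => by
      simp only [hp, Function.iterate_succ_apply', hab]
    have hsub : (⋃ i < n, segment ℝ (p i) (p (i + 1))) ⊆ ⋃ x ∈ S, segment ℝ (a x) (b x) := by
      refine iUnion₂_subset fun i _ => ?_
      rw [hps]
      exact subset_biUnion_of_mem (u := fun x => segment ℝ (a x) (b x)) (hmem i)
    have hsub' : (⋃ x ∈ S \ O, segment ℝ (a x) (b x)) ⊆ ⋃ x ∈ S, segment ℝ (a x) (b x) :=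
      biUnion_subset_biUnion_left fun x hx => (Finset.mem_sdiff.1 hx).1
    refine ⟨Finsupp.single (polygon p hn0 hpn) 1 + Γ, ?_, fun g hg => ?_⟩
    · refine (LoopCycle.trace_add_subset _ _).trans (union_subset ?_ (hΓt.trans hsub'))
      rw [LoopCycle.trace_single]
      exact (trace_polygon_subset p hn0 hpn).trans hsub
    · rw [LoopCycle.integral_add_cycle, LoopCycle.integral_single,
        integral_polygon p hn0 hpn (hg.mono hsub), hΓi g (hg.mono hsub'), add_comm,
        ← Finset.sum_sdiff hOS, hO, Finset.sum_image]
      · simp only [hps]; rfl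
      · intro i hi j hj hij
        exact Function.iterate_injOn_Iio_minimalPeriod (Finset.mem_range.1 hi)
          (Finset.mem_range.1 hj) hij

/-! ### The square grid and the boundary of a finite union of squares -/

namespace SquareGrid

/-- The corners of the square with center `0`, relative to the corner `(1 / 2, 1 / 2)`. -/
def corner : Fin 4 → ℤ × ℤ := ![(0, -1), (0, 0), (-1, 0), (-1, -1)]

/-- The outward normals of the sides of a square. -/
def normal : Fin 4 → ℤ × ℤ := ![(1, 0), (0, 1), (-1, 0), (0, -1)]

/-- Together with `corner_add_one_eq`: the side `d` of a square is the side `d + 2` of the neighbour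
across it, traversed backwards. -/
theorem corner_eq (d : Fin 4) : corner d = normal d + corner (d + 3) := by
  revert d; decide

theorem corner_add_one_eq (d : Fin 4) : corner (d + 1) = normal d + corner (d + 2) := by
  revert d; decide

theorem normal_ne_zero (d : Fin 4) : normal d ≠ 0 := by
  revert d; decide

theorem normal_add_two (d : Fin 4) : normal (d + 2) = -normal d := by
  revert d; decide

variable (δ : ℝ)

/-- The closed square of side `δ` with center `δ s`. -/
def square (s : ℤ × ℤ) : Set ℂ := {z | |z.re - δ * s.1| ≤ δ / 2 ∧ |z.im - δ * s.2| ≤ δ / 2}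

/-- The center of a square. -/
def center (s : ℤ × ℤ) : ℂ := ⟨δ * s.1, δ * s.2⟩

/-- The vertices of the grid. -/
noncomputable def vertex (v : ℤ × ℤ) : ℂ := ⟨δ * (v.1 + 1 / 2), δ * (v.2 + 1 / 2)⟩

/-- The initial point of the side `d` of the square `s`. -/
noncomputable def source (x : (ℤ × ℤ) × Fin 4) : ℂ := vertex δ (x.1 + corner x.2)

/-- The end point of the side `d` of the square `s`. -/
noncomputable def target (x : (ℤ × ℤ) × Fin 4) : ℂ := vertex δ (x.1 + corner (x.2 + 1))

variable {δ}

theorem convex_square (s : ℤ × ℤ) : Convex ℝ (square δ s) := by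
  have h1 : Convex ℝ (Icc (δ * s.1 - δ / 2) (δ * s.1 + δ / 2)) := convex_Icc _ _
  have h2 : Convex ℝ (Icc (δ * s.2 - δ / 2) (δ * s.2 + δ / 2)) := convex_Icc _ _
  have h : square δ s = Complex.reLm ⁻¹' Icc (δ * s.1 - δ / 2) (δ * s.1 + δ / 2) ∩
      Complex.imLm ⁻¹' Icc (δ * s.2 - δ / 2) (δ * s.2 + δ / 2) := by
    ext z
    simp only [square, mem_ofPred_eq, abs_le, mem_inter_iff, mem_preimage, Complex.reLm_coe,
      Complex.imLm_coe, mem_Icc]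
    constructor <;> rintro ⟨⟨h1, h2⟩, h3, h4⟩ <;> refine ⟨⟨?_, ?_⟩, ?_, ?_⟩ <;> linarith
  rw [h]
  exact (h1.linear_preimage Complex.reLm).inter (h2.linear_preimage Complex.imLm)

theorem vertex_mem_square (hδ : 0 < δ) (s : ℤ × ℤ) (d : Fin 4) :
    vertex δ (s + corner d) ∈ square δ s := by
  fin_cases d <;> simp [vertex, square, corner, abs_le] <;>
    refine ⟨⟨?_, ?_⟩, ?_, ?_⟩ <;> linarith

theorem segment_subset_square (hδ : 0 < δ) (x : (ℤ × ℤ) × Fin 4) :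
    segment ℝ (source δ x) (target δ x) ⊆ square δ x.1 :=
  (convex_square x.1).segment_subset (vertex_mem_square hδ _ _) (vertex_mem_square hδ _ _)

theorem segment_subset_square_add_normal (hδ : 0 < δ) (x : (ℤ × ℤ) × Fin 4) :
    segment ℝ (source δ x) (target δ x) ⊆ square δ (x.1 + normal x.2) := by
  rw [source, target, corner_eq, corner_add_one_eq, ← add_assoc, ← add_assoc]
  exact (convex_square _).segment_subset (vertex_mem_square hδ _ _) (vertex_mem_square hδ _ _)

theorem square_subset_ball (hδ : 0 < δ) (s : ℤ × ℤ) :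
    square δ s ⊆ Metric.ball (center δ s) δ := by
  rintro z ⟨h1, h2⟩
  rw [Metric.mem_ball, Complex.dist_eq_re_im, Real.sqrt_lt' hδ]
  have h1 := sq_le_sq' (abs_le.1 h1).1 (abs_le.1 h1).2
  have h2 := sq_le_sq' (abs_le.1 h2).1 (abs_le.1 h2).2
  simp only [center]
  nlinarith

theorem exists_mem_square (hδ : 0 < δ) (z : ℂ) : ∃ s, z ∈ square δ s := by
  have h : ∀ x : ℝ, |x - δ * (round (x / δ) : ℤ)| ≤ δ / 2 := fun x => by
    have := mul_le_mul_of_nonneg_left (abs_sub_round (x / δ)) hδ.le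
    rw [← abs_of_pos hδ, ← abs_mul, abs_of_pos hδ, mul_sub, mul_div_cancel₀ _ hδ.ne'] at this
    linarith
  exact ⟨(round (z.re / δ), round (z.im / δ)), h _, h _⟩

theorem le_dist_center (hδ : 0 < δ) {s s' : ℤ × ℤ} (h : s ≠ s') :
    δ ≤ dist (center δ s) (center δ s') := by
  have key : ∀ m n : ℤ, m ≠ n → δ ≤ |δ * m - δ * n| := fun m n hmn => by
    rw [← mul_sub, abs_mul, abs_of_pos hδ]
    have : (1 : ℝ) ≤ |(m : ℝ) - n| := by
      exact_mod_cast Int.one_le_abs (sub_ne_zero.2 hmn)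
    nlinarith
  rw [Complex.dist_eq]
  by_cases h1 : s.1 = s'.1
  · exact (key s.2 s'.2 fun h2 => h (Prod.ext h1 h2)).trans
      (Complex.abs_im_le_norm (center δ s - center δ s'))
  · exact (key s.1 s'.1 h1).trans (Complex.abs_re_le_norm (center δ s - center δ s'))

/-- Points of the segment other than `z` lie in the interior of the square, which no other closed
square of the grid meets. This allows a point of `K` to be joined to the center of a square without
crossing the boundary sides. -/
theorem eq_of_mem_segment_center (hδ : 0 < δ) {s s' : ℤ × ℤ} {z y : ℂ} (hz : z ∈ square δ s)
    (hy : y ∈ segment ℝ (center δ s) z) (hyz : y ≠ z) (hy' : y ∈ square δ s') : s' = s := by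
  rw [segment_eq_image'] at hy
  obtain ⟨θ, ⟨h0, h1⟩, rfl⟩ := hy
  have hθ : θ < 1 := lt_of_le_of_ne h1 fun h => hyz (by simp [h])
  have key : ∀ (m n : ℤ) (x : ℝ), |x - δ * m| ≤ δ / 2 →
      |δ * m + θ * (x - δ * m) - δ * n| ≤ δ / 2 → n = m := fun m n x hx hn => by
    have h2 : |θ * (x - δ * m)| < δ / 2 := by
      rw [abs_mul, abs_of_nonneg h0]
      nlinarith [abs_nonneg (x - δ * m)]
    have h3 : |δ * ((n : ℝ) - m)| < δ := by
      rw [abs_lt] at h2 ⊢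
      rw [abs_le] at hn
      constructor <;> nlinarith
    rw [abs_mul, abs_of_pos hδ] at h3
    have h4 : |(n : ℝ) - m| < 1 := by nlinarith
    have h5 : |n - m| < 1 := by exact_mod_cast h4
    exact sub_eq_zero.1 (Int.abs_lt_one_iff.1 h5)
  exact Prod.ext (key _ _ _ hz.1 (by simpa [center] using hy'.1))
    (key _ _ _ hz.2 (by simpa [center] using hy'.2))

/-- A primitive exists on a disc containing the square, and its increments along the four sides
telescope. -/
theorem sum_sides_eq_zero (hδ : 0 < δ) (s : ℤ × ℤ) {g : ℂ → ℂ}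
    (hg : DifferentiableOn ℂ g (Metric.ball (center δ s) δ)) :
    ∑ d, segmentIntegral (source δ (s, d)) (target δ (s, d)) g = 0 := by
  obtain ⟨G, hG⟩ := hg.isExactOn_ball
  have h : ∀ d, segmentIntegral (source δ (s, d)) (target δ (s, d)) g =
      G (target δ (s, d)) - G (source δ (s, d)) := fun d => by
    have hsub := (segment_subset_square hδ (s, d)).trans (square_subset_ball hδ s)
    exact segmentIntegral_eq_sub (fun z hz => hG z (hsub hz)) (hg.continuousOn.mono hsub)
  rw [Finset.sum_congr rfl fun d _ => h d]
  simp only [Fin.sum_univ_four, source, target]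
  simp only [show (0 : Fin 4) + 1 = 1 from rfl, show (1 : Fin 4) + 1 = 2 from rfl,
    show (2 : Fin 4) + 1 = 3 from rfl, show (3 : Fin 4) + 1 = 0 from rfl]
  ring

/-- Seen from `c`, the segment makes a quarter turn. Scaling by `u` reduces it to the segment from
`1` to `I`, where the principal logarithm is a primitive. -/
theorem segmentIntegral_inv_sub_rotate {c u : ℂ} (hu : u ≠ 0) :
    segmentIntegral (c + u) (c + u * Complex.I) (fun w => (w - c)⁻¹) =
      Real.pi / 2 * Complex.I := by
  have hs : segment ℝ 1 Complex.I ⊆ Complex.slitPlane := by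
    rw [segment_eq_image']
    rintro _ ⟨t, ⟨h0, h1⟩, rfl⟩
    rw [Complex.mem_slitPlane_iff]
    by_cases h : t = 0
    · exact Or.inl (by simp [h])
    · exact Or.inr (by simp [h])
  have h : segmentIntegral (c + u) (c + u * Complex.I) (fun w => (w - c)⁻¹) =
      segmentIntegral 1 Complex.I fun w => w⁻¹ := by
    simp only [segmentIntegral]
    congr 1
    ext t
    rw [show c + u + t * (c + u * Complex.I - (c + u)) - c =
      u * (1 + t * (Complex.I - 1)) by ring, mul_inv]
    field_simp
    ring
  rw [h, segmentIntegral_eq_sub (G := Complex.log) (fun z hz => Complex.hasDerivAt_log (hs hz))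
    (continuousOn_inv₀.mono fun z hz => Complex.slitPlane_ne_zero (hs hz)), Complex.log_I,
    Complex.log_one, sub_zero]

theorem sum_sides_inv_sub_center (hδ : 0 < δ) (s : ℤ × ℤ) :
    ∑ d, segmentIntegral (source δ (s, d)) (target δ (s, d)) (fun w => (w - center δ s)⁻¹) =
      2 * Real.pi * Complex.I := by
  have hu : (⟨δ / 2, -(δ / 2)⟩ : ℂ) ≠ 0 := fun h => by
    have := congrArg Complex.re h
    simp at this
    exact hδ.ne' this
  have hd : ∀ d : Fin 4, ∃ u : ℂ, u ≠ 0 ∧ source δ (s, d) = center δ s + u ∧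
      target δ (s, d) = center δ s + u * Complex.I := fun d => by
    -- The lower right corner seen from the center, turned by `d` right angles.
    refine ⟨⟨δ / 2, -(δ / 2)⟩ * Complex.I ^ (d : ℕ), mul_ne_zero hu (pow_ne_zero _ Complex.I_ne_zero),
      ?_, ?_⟩ <;> fin_cases d <;>
      simp [source, target, vertex, center, corner, Complex.ext_iff, pow_succ] <;>
      (try constructor) <;> ring
  have hd' : ∀ d : Fin 4, segmentIntegral (source δ (s, d)) (target δ (s, d))
      (fun w => (w - center δ s)⁻¹) = Real.pi / 2 * Complex.I := fun d => by
    obtain ⟨u, hu, h1, h2⟩ := hd d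
    rw [h1, h2, segmentIntegral_inv_sub_rotate hu]
  simp only [hd', Finset.sum_const, Finset.card_univ, Fintype.card_fin, nsmul_eq_mul]
  push_cast
  ring

variable (S : Finset (ℤ × ℤ))

/-- The sides of the squares in `S` that belong to only one square in `S`. -/
def boundary : Finset ((ℤ × ℤ) × Fin 4) :=
  (S ×ˢ Finset.univ).filter fun x => x.1 + normal x.2 ∉ S

theorem mem_boundary {x : (ℤ × ℤ) × Fin 4} :
    x ∈ boundary S ↔ x.1 ∈ S ∧ x.1 + normal x.2 ∉ S := by
  simp [boundary]

/-- A side between two squares of `S` occurs twice with opposite orientations; passing to the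
neighbour is a fixed-point-free involution that cancels these terms. -/
theorem sum_boundary (g : ℂ → ℂ) :
    ∑ x ∈ boundary S, segmentIntegral (source δ x) (target δ x) g =
      ∑ s ∈ S, ∑ d, segmentIntegral (source δ (s, d)) (target δ (s, d)) g := by
  rw [← Finset.sum_product', ← Finset.sum_filter_add_sum_filter_not (S ×ˢ Finset.univ)
    (fun x => x.1 + normal x.2 ∉ S), boundary, eq_comm, add_eq_left]
  refine Finset.sum_involution (fun x _ => (x.1 + normal x.2, x.2 + 2)) ?_ ?_ ?_ ?_
  · intro x _
    have h1 : source δ (x.1 + normal x.2, x.2 + 2) = target δ x := by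
      rw [source, target, corner_add_one_eq, add_assoc]
    have h2 : target δ (x.1 + normal x.2, x.2 + 2) = source δ x := by
      rw [source, target, corner_eq x.2, ← add_assoc, add_assoc x.2]
      rfl
    rw [h1, h2, segmentIntegral_symm, neg_add_cancel]
  · intro x _ _ h
    have := congrArg Prod.fst h
    simp only [add_eq_left] at this
    exact normal_ne_zero _ this
  · intro x hx
    simp only [Finset.mem_filter, Finset.mem_product, Finset.mem_univ, and_true, not_not] at hx ⊢
    refine ⟨hx.2, ?_⟩
    rw [normal_add_two, add_neg_cancel_right]
    exact hx.1
  · intro x _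
    refine Prod.ext ?_ ?_
    · simp only [normal_add_two, add_neg_cancel_right]
    · simp only [add_assoc]
      exact add_zero _

/-- At each vertex as many boundary sides end as start: going once round the four squares at the
vertex, one leaves `S` as often as one enters it. Bijections between the two kinds of sides at every
vertex assemble to `σ`. -/
theorem exists_perm_boundary : ∃ σ : Equiv.Perm (boundary S), ∀ x : boundary S,
    (σ x).1.1 + corner (σ x).1.2 = x.1.1 + corner (x.1.2 + 1) := by
  classical
  have hcard : ∀ (k : Fin 4) (v : ℤ × ℤ),
      Fintype.card {x : boundary S // x.1.1 + corner (x.1.2 + k) = v} =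
        ∑ d : Fin 4, if v - corner (d + k) ∈ S ∧ v - corner (d + k) + normal d ∉ S then 1 else 0 := by
    intro k v
    rw [← Finset.card_filter, ← Fintype.card_subtype]
    refine Fintype.card_congr ⟨fun x => ⟨x.1.1.2, ?_⟩, fun d => ⟨⟨(v - corner (d.1 + k), d.1),
      (mem_boundary S).2 d.2⟩, sub_add_cancel _ _⟩, fun x => ?_, fun d => rfl⟩
    · rw [sub_eq_iff_eq_add.2 x.2.symm]
      exact (mem_boundary S).1 x.1.2
    · obtain ⟨⟨⟨s, d⟩, hx⟩, rfl⟩ := x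
      simp
  have key : ∀ v : ℤ × ℤ, Nonempty ({x : boundary S // x.1.1 + corner (x.1.2 + 1) = v} ≃
      {x : boundary S // x.1.1 + corner x.1.2 = v}) := by
    intro v
    refine Fintype.card_eq.1 ?_
    have h0 := hcard 0 v
    simp only [add_zero] at h0
    rw [hcard 1 v, h0]
    have e1 : ∀ d, v - corner (d + 1) + normal d = v - corner (d + 2) := fun d => by
      rw [corner_add_one_eq]; abel
    have e2 : ∀ d, v - corner d + normal d = v - corner (d + 3) := fun d => by
      rw [corner_eq]; abel
    simp only [e1, e2, Fin.sum_univ_four]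
    simp only [show (0 : Fin 4) + 1 = 1 from rfl, show (1 : Fin 4) + 1 = 2 from rfl,
      show (2 : Fin 4) + 1 = 3 from rfl, show (3 : Fin 4) + 1 = 0 from rfl,
      show (0 : Fin 4) + 2 = 2 from rfl, show (1 : Fin 4) + 2 = 3 from rfl,
      show (2 : Fin 4) + 2 = 0 from rfl, show (3 : Fin 4) + 2 = 1 from rfl,
      show (0 : Fin 4) + 3 = 3 from rfl, show (1 : Fin 4) + 3 = 0 from rfl,
      show (2 : Fin 4) + 3 = 1 from rfl, show (3 : Fin 4) + 3 = 2 from rfl]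
    by_cases h0 : v - corner 0 ∈ S <;> by_cases h1 : v - corner 1 ∈ S <;>
      by_cases h2 : v - corner 2 ∈ S <;> by_cases h3 : v - corner 3 ∈ S <;>
      simp [h0, h1, h2, h3]
  exact ⟨Equiv.ofFiberEquiv fun v => (key v).some,
    Equiv.ofFiberEquiv_map (f := fun x : boundary S => x.1.1 + corner (x.1.2 + 1))
      (g := fun x : boundary S => x.1.1 + corner x.1.2) fun v => (key v).some⟩

theorem exists_loopCycle (δ : ℝ) : ∃ Γ : LoopCycle,
    LoopCycle.trace Γ ⊆ ⋃ x ∈ boundary S, segment ℝ (source δ x) (target δ x) ∧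
      ∀ g : ℂ → ℂ, ContinuousOn g (⋃ x ∈ boundary S, segment ℝ (source δ x) (target δ x)) →
        LoopCycle.integral Γ g =
          ∑ s ∈ S, ∑ d, segmentIntegral (source δ (s, d)) (target δ (s, d)) g := by
  obtain ⟨σ, hσ⟩ := exists_perm_boundary S
  obtain ⟨Γ, hΓt, hΓi⟩ := σ.exists_loopCycle (fun x => source δ x) (fun x => target δ x)
    (fun x => by rw [source, target, hσ]) Finset.univ fun _ _ => Finset.mem_univ _
  have hU : (⋃ x ∈ (Finset.univ : Finset (boundary S)), segment ℝ (source δ x) (target δ x)) =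
      ⋃ x ∈ boundary S, segment ℝ (source δ x) (target δ x) := by
    ext z
    simp
  rw [hU] at hΓt hΓi
  refine ⟨Γ, hΓt, fun g hg => ?_⟩
  rw [hΓi g hg, ← sum_boundary, ← Finset.sum_coe_sort (boundary S)]

theorem finite_setOf_square_inter_nonempty (hδ : 0 < δ) {K : Set ℂ} (hK : IsCompact K) :
    {s : ℤ × ℤ | (square δ s ∩ K).Nonempty}.Finite := by
  obtain ⟨R, hR⟩ := hK.isBounded.exists_norm_le
  have key : ∀ (x : ℝ) (m : ℤ), |x - δ * m| ≤ δ / 2 → |x| ≤ R →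
      m ∈ Icc (-⌈(R + δ) / δ⌉) ⌈(R + δ) / δ⌉ := fun x m h1 h2 => by
    rw [mem_Icc, ← abs_le]
    have h3 : |(m : ℝ)| ≤ (R + δ) / δ := by
      rw [le_div_iff₀ hδ, ← abs_of_pos hδ, ← abs_mul, abs_of_pos hδ]
      rw [abs_le] at *
      constructor <;> nlinarith
    exact_mod_cast h3.trans (Int.le_ceil _)
  refine ((finite_Icc (-⌈(R + δ) / δ⌉) ⌈(R + δ) / δ⌉).prod
    (finite_Icc (-⌈(R + δ) / δ⌉) ⌈(R + δ) / δ⌉)).subset ?_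
  rintro s ⟨z, hz, hzK⟩
  exact ⟨key _ _ hz.1 ((Complex.abs_re_le_norm z).trans (hR z hzK)),
    key _ _ hz.2 ((Complex.abs_im_le_norm z).trans (hR z hzK))⟩

end SquareGrid

/-! ### Existence of surrounding cycles -/

open SquareGrid in
/-- Every compact set in an open set `Ω` is surrounded in `Ω` by a cycle along which the integrals
of the holomorphic functions in `Ω` vanish. -/
theorem IsCompact.exists_surrounds_integral_eq_zero {K Ω : Set ℂ} (hK : IsCompact K)
    (hΩ : IsOpen Ω) (hKΩ : K ⊆ Ω) :
    ∃ Γ : LoopCycle, LoopCycle.Surrounds Γ K Ω ∧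
      ∀ g : ℂ → ℂ, DifferentiableOn ℂ g Ω → LoopCycle.integral Γ g = 0 := by
  obtain ⟨ε, hε, hεΩ⟩ := hK.exists_thickening_subset_open hΩ hKΩ
  -- If a square meets `K`, the disc of radius `δ` about its center lies within `2 * δ = ε` of `K`.
  set δ := ε / 2 with hδε
  have hδ : 0 < δ := half_pos hε
  set S := (finite_setOf_square_inter_nonempty hδ hK).toFinset with hSdef
  have hS : ∀ s, s ∈ S ↔ (square δ s ∩ K).Nonempty := fun s => by simp [S]
  have hball : ∀ s ∈ S, Metric.ball (center δ s) δ ⊆ Ω := fun s hs => by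
    obtain ⟨z, hz, hzK⟩ := (hS s).1 hs
    have hz := square_subset_ball hδ s hz
    refine fun w hw => hεΩ (Metric.mem_thickening_iff.2 ⟨z, hzK, ?_⟩)
    rw [Metric.mem_ball] at hz hw
    have := dist_triangle_right w z (center δ s)
    linarith
  obtain ⟨Γ, hΓt, hΓi⟩ := exists_loopCycle S δ
  set B := ⋃ x ∈ boundary S, segment ℝ (source δ x) (target δ x) with hB
  have hBs : ∀ z ∈ B, ∃ x : (ℤ × ℤ) × Fin 4, x.1 ∈ S ∧ x.1 + normal x.2 ∉ S ∧
      z ∈ square δ x.1 ∧ z ∈ square δ (x.1 + normal x.2) := fun z hz => by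
    obtain ⟨x, hx, hz⟩ := mem_iUnion₂.1 hz
    obtain ⟨h1, h2⟩ := (mem_boundary S).1 hx
    exact ⟨x, h1, h2, segment_subset_square hδ x hz, segment_subset_square_add_normal hδ x hz⟩
  -- A boundary side also lies in the neighbouring square, which is not in `S` and hence misses `K`.
  have hBK : B ⊆ Ω \ K := fun z hz => by
    obtain ⟨x, h1, h2, h3, h4⟩ := hBs z hz
    exact ⟨hball _ h1 (square_subset_ball hδ _ h3), fun hzK => h2 ((hS _).2 ⟨z, h4, hzK⟩)⟩
  have hzero : ∀ g : ℂ → ℂ, DifferentiableOn ℂ g Ω → LoopCycle.integral Γ g = 0 := fun g hg => by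
    rw [hΓi g (hg.continuousOn.mono (hBK.trans sdiff_subset))]
    exact Finset.sum_eq_zero fun s hs => sum_sides_eq_zero hδ s (hg.mono (hball s hs))
  have hdiff : ∀ (ζ : ℂ) (U : Set ℂ), ζ ∉ U → DifferentiableOn ℂ (fun w => (w - ζ)⁻¹) U :=
    fun ζ U hζ => (differentiableOn_id.sub_const ζ).inv fun w hw h =>
      hζ (sub_eq_zero.1 h ▸ hw)
  have hcB : ∀ s ∈ S, ∀ z ∈ K, z ∈ square δ s → Disjoint (segment ℝ (center δ s) z) B := by
    intro s hs z hzK hzs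
    refine disjoint_left.2 fun y hy hyB => ?_
    obtain ⟨x, h1, h2, h3, h4⟩ := hBs y hyB
    have hyz : y ≠ z := fun h => (hBK hyB).2 (h ▸ hzK)
    refine normal_ne_zero x.2 ((add_eq_left (a := x.1)).1 ?_)
    rw [eq_of_mem_segment_center hδ hzs hy hyz h4, eq_of_mem_segment_center hδ hzs hy hyz h3]
  refine ⟨Γ, ⟨hΓt.trans hBK, fun z hz => ?_, fun ζ hζ => ?_⟩, hzero⟩
  · obtain ⟨s, hzs⟩ := exists_mem_square hδ z
    have hs : s ∈ S := (hS s).2 ⟨z, hzs, hz⟩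
    have hdis := hcB s hs z hz hzs
    -- The index is moved from `z` to the center of its square; there that square contributes `2πi`
    -- and every other square nothing.
    rw [← LoopCycle.index_eq_of_segment Γ (hdis.mono_right hΓt), LoopCycle.index,
      hΓi _ (hdiff _ _ fun h => disjoint_left.1 hdis (left_mem_segment ℝ _ _) h).continuousOn,
      Finset.sum_eq_single_of_mem s hs, sum_sides_inv_sub_center hδ s,
      inv_mul_cancel₀ Complex.two_pi_I_ne_zero]
    intro s' _ hne
    refine sum_sides_eq_zero hδ s' (hdiff _ _ fun h => ?_)
    exact not_lt.2 (le_dist_center hδ hne.symm) (Metric.mem_ball.1 h)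
  · rw [LoopCycle.index, hzero _ (hdiff ζ Ω hζ), mul_zero]
-- Cauchy's theorem and formula for cycles
namespace LoopCycle

theorem continuousOn_inv_sub {Γ : LoopCycle} {z : ℂ} (hz : z ∉ LoopCycle.trace Γ) :
    ContinuousOn (fun w => (w - z)⁻¹) (LoopCycle.trace Γ) :=
  (continuousOn_id.sub continuousOn_const).inv₀ fun w hw h =>
    hz ((sub_eq_zero.1 h : w = z) ▸ hw)

theorem integral_inv_sub (Γ : LoopCycle) (z : ℂ) :
    LoopCycle.integral Γ (fun w => (w - z)⁻¹) =
      2 * Real.pi * Complex.I * LoopCycle.index Γ z := by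
  rw [LoopCycle.index, mul_inv_cancel_left₀ Complex.two_pi_I_ne_zero]

/-- On the trace `dslope h z w` is `(h w - h z) / (w - z)`. Assuming the vanishing of this one
integral makes the formula usable for grid cycles, before Cauchy's theorem for general cycles is
available. -/
theorem integral_inv_sub_mul_of_dslope {Γ : LoopCycle} {z : ℂ} {h : ℂ → ℂ}
    (hz : z ∉ LoopCycle.trace Γ) (hc : ContinuousOn h (LoopCycle.trace Γ))
    (hd : LoopCycle.integral Γ (dslope h z) = 0) :
    LoopCycle.integral Γ (fun w => (w - z)⁻¹ * h w) =
      2 * Real.pi * Complex.I * (LoopCycle.index Γ z * h z) := by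
  have hi := continuousOn_inv_sub hz
  have h1 : EqOn (dslope h z) (fun w => (w - z)⁻¹ * h w - h z • (w - z)⁻¹)
      (LoopCycle.trace Γ) := fun w hw => by
    have hwz : w ≠ z := fun hwz => hz (hwz ▸ hw)
    rw [dslope_of_ne h hwz, slope_def_field]
    simp only [smul_eq_mul]
    ring
  rw [integral_congr Γ h1, integral_sub Γ (g := fun w => (w - z)⁻¹ * h w)
    (h := fun w => h z • (w - z)⁻¹) (hi.mul hc) (hi.const_smul (h z)), integral_smul,
    integral_inv_sub, sub_eq_zero] at hd
  rw [hd, smul_eq_mul]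
  ring

theorem hull_subset {Γ : LoopCycle} {U : Set ℂ} (hΓ : LoopCycle.trace Γ ⊆ U)
    (hind : ∀ ζ ∉ U, LoopCycle.index Γ ζ = 0) : hull Γ ⊆ U :=
  union_subset hΓ fun z hz => by
    by_contra h
    exact hz (hind z h)

/-- Take a grid cycle `γ` around the hull of `Γ`. Cauchy's formula along `γ` expresses `h` on `Γ`;
after interchanging the integrals, the inner one is a multiple of the index of `Γ` about a point of
`γ`, which is zero. -/
theorem integral_eq_zero_of_index_eq_zero_complex {Γ : LoopCycle} {U : Set ℂ} (hU : IsOpen U)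
    (hΓ : LoopCycle.trace Γ ⊆ U) (hind : ∀ ζ ∉ U, LoopCycle.index Γ ζ = 0) {h : ℂ → ℂ}
    (hh : DifferentiableOn ℂ h U) : LoopCycle.integral Γ h = 0 := by
  obtain ⟨γ, hγ, hγ0⟩ := (isCompact_hull Γ).exists_surrounds_integral_eq_zero hU
    (hull_subset hΓ hind)
  have hγt : ∀ w ∈ LoopCycle.trace γ, w ∉ LoopCycle.trace Γ ∧ LoopCycle.index Γ w = 0 :=
    fun w hw => ⟨fun h => (hγ.trace_subset hw).2 (Or.inl h), by
      by_contra h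
      exact (hγ.trace_subset hw).2 (Or.inr h)⟩
  have hγU : LoopCycle.trace γ ⊆ U := hγ.trace_subset.trans sdiff_subset
  have h1 : ∀ z ∈ LoopCycle.trace Γ, LoopCycle.integral γ (fun w => (w - z)⁻¹ * h w) =
      2 * Real.pi * Complex.I * h z := fun z hz => by
    rw [integral_inv_sub_mul_of_dslope (fun hw => (hγt z hw).1 hz) (hh.continuousOn.mono hγU)
      (hγ0 _ ((Complex.differentiableOn_dslope (hU.mem_nhds (hΓ hz))).2 hh)),
      hγ.index_eq_one z (Or.inl hz), one_mul]
  have h2 : LoopCycle.integral Γ (fun z => (2 * Real.pi * Complex.I) • h z) = 0 := by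
    rw [integral_congr Γ (g := fun z => (2 * Real.pi * Complex.I) • h z)
      fun z hz => (h1 z hz).symm, integral_integral_swap]
    -- Zero is written as a scalar multiple so that `integral_smul` evaluates the integral.
    · have h3 : EqOn (fun w => LoopCycle.integral Γ fun z => (w - z)⁻¹ * h w) (fun _ => (0 : ℂ) • 0)
          (LoopCycle.trace γ) := fun w hw => by
        have h4 : (fun z => (w - z)⁻¹ * h w) = fun z => (-h w) • (z - w)⁻¹ := by
          ext z
          rw [← neg_sub z w, inv_neg, smul_eq_mul]
          ring
        simp only
        rw [h4, integral_smul, integral_inv_sub, (hγt w hw).2, mul_zero, smul_zero, smul_zero]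
      rw [integral_congr γ h3, integral_smul, zero_smul]
    · refine ContinuousOn.mul (ContinuousOn.inv₀ (by fun_prop) fun p hp hp' => ?_)
        ((hh.continuousOn.mono hγU).comp continuousOn_snd fun p hp => hp.2)
      exact (hγt p.2 hp.2).1 (sub_eq_zero.1 hp' ▸ hp.1)
  rw [integral_smul, smul_eq_mul] at h2
  exact (mul_eq_zero.1 h2).resolve_left Complex.two_pi_I_ne_zero

/-- The homological form of Cauchy's integral theorem. -/
theorem integral_eq_zero_of_index_eq_zero {E : Type*} [NormedAddCommGroup E] [NormedSpace ℂ E]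
    [CompleteSpace E] {Γ : LoopCycle} {U : Set ℂ} (hU : IsOpen U)
    (hΓ : LoopCycle.trace Γ ⊆ U) (hind : ∀ ζ ∉ U, LoopCycle.index Γ ζ = 0) {h : ℂ → E}
    (hh : DifferentiableOn ℂ h U) : LoopCycle.integral Γ h = 0 := by
  -- By Hahn–Banach it suffices to test against continuous functionals.
  refine SeparatingDual.eq_zero_of_forall_dual_eq_zero (R := ℂ) fun L => ?_
  rw [map_integral Γ L (hh.continuousOn.mono hΓ)]
  exact integral_eq_zero_of_index_eq_zero_complex hU hΓ hind (L.differentiable.comp_differentiableOn hh)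

/-- The homological form of Cauchy's integral formula. -/
theorem integral_inv_sub_mul {Γ : LoopCycle} {U : Set ℂ} (hU : IsOpen U)
    (hΓ : LoopCycle.trace Γ ⊆ U) (hind : ∀ ζ ∉ U, LoopCycle.index Γ ζ = 0) {h : ℂ → ℂ}
    (hh : DifferentiableOn ℂ h U) {z : ℂ} (hz : z ∈ U) (hzΓ : z ∉ LoopCycle.trace Γ) :
    LoopCycle.integral Γ (fun w => (w - z)⁻¹ * h w) =
      2 * Real.pi * Complex.I * (LoopCycle.index Γ z * h z) :=
  integral_inv_sub_mul_of_dslope hzΓ (hh.continuousOn.mono hΓ)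
    (integral_eq_zero_of_index_eq_zero hU hΓ hind
      ((Complex.differentiableOn_dslope (hU.mem_nhds hz)).2 hh))

theorem integral_smul_const {E : Type*} [NormedAddCommGroup E] [NormedSpace ℂ E]
    [CompleteSpace E] {Γ : LoopCycle} {φ : ℂ → ℂ} (hφ : ContinuousOn φ (LoopCycle.trace Γ)) (v : E) :
    LoopCycle.integral Γ (fun z => φ z • v) = LoopCycle.integral Γ φ • v :=
  (map_integral Γ ((ContinuousLinearMap.id ℂ ℂ).smulRight v) hφ).symm

theorem Surrounds.mono {Γ : LoopCycle} {K K' Ω Ω' : Set ℂ} (h : LoopCycle.Surrounds Γ K Ω)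
    (hK : K' ⊆ K) (hΩ : Ω ⊆ Ω') : LoopCycle.Surrounds Γ K' Ω' :=
  ⟨h.trace_subset.trans (sdiff_subset_sdiff hΩ hK), fun ζ hζ => h.index_eq_one ζ (hK hζ),
    fun ζ hζ => h.index_eq_zero ζ fun h => hζ (hΩ h)⟩

end LoopCycle

/-! ### Circles as cycles -/

section Circle

/-- The circle of radius `R` about `0`. -/
noncomputable def circleLoop (R : ℝ) : PwC1Loop where
  toFun t := circleMap 0 R (2 * Real.pi * t)
  continuousOn' := by fun_prop
  closed' := by simp [circleMap]
  piecewise_C1' := ⟨1, fun i => i, Nat.mono_cast, by simp, by simp, fun _ _ =>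
    ((contDiff_circleMap 0 R).comp (contDiff_const.mul contDiff_id)).contDiffOn⟩

theorem integral_circleLoop {E : Type*} [NormedAddCommGroup E] [NormedSpace ℂ E] (R : ℝ)
    (g : ℂ → E) : (circleLoop R).integral g = ∮ z in C(0, R), g z := by
  have hd : ∀ t : ℝ, deriv (circleLoop R).toFun t =
      (2 * Real.pi : ℝ) • deriv (circleMap 0 R) (2 * Real.pi * t) := fun t =>
    deriv_comp_mul_left (2 * Real.pi) (circleMap 0 R) t
  rw [PwC1Loop.integral]
  simp only [hd, smul_assoc]
  rw [intervalIntegral.integral_smul]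
  have := intervalIntegral.smul_integral_comp_mul_left
    (fun θ => deriv (circleMap 0 R) θ • g (circleMap 0 R θ)) (2 * Real.pi) (a := 0) (b := 1)
  rw [mul_zero, mul_one] at this
  exact this

theorem surrounds_circleLoop {R : ℝ} (hR : 0 ≤ R) {K : Set ℂ} (hK : K ⊆ Metric.ball 0 R) :
    LoopCycle.Surrounds (Finsupp.single (circleLoop R) 1) K univ := by
  refine ⟨?_, fun ζ hζ => ?_, fun ζ hζ => absurd (mem_univ ζ) hζ⟩
  · rw [LoopCycle.trace_single]
    rintro _ ⟨t, _, rfl⟩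
    refine ⟨mem_univ _, fun h => ?_⟩
    have h1 : circleMap 0 R (2 * Real.pi * t) ∈ Metric.sphere (0 : ℂ) R := circleMap_mem_sphere 0 hR _
    have h2 := Metric.mem_ball.1 (hK h)
    exact h2.ne h1
  · rw [LoopCycle.index, LoopCycle.integral_single, integral_circleLoop,
      circleIntegral.integral_sub_inv_of_mem_ball (hK hζ), inv_mul_cancel₀ Complex.two_pi_I_ne_zero]

end Circle
-- Resolvent identities
section ResolventIdentities

variable {𝒜 : Type*} [NormedRing 𝒜] [NormedAlgebra ℂ 𝒜] {A : 𝒜} {z w : ℂ}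

theorem sub_mul_resolvent (hz : z ∉ spectrum ℂ A) :
    (algebraMap ℂ 𝒜 z - A) * resolvent A z = 1 :=
  Ring.mul_inverse_cancel _ (spectrum.notMem_iff.1 hz)

theorem resolvent_mul_sub (hz : z ∉ spectrum ℂ A) :
    resolvent A z * (algebraMap ℂ 𝒜 z - A) = 1 :=
  Ring.inverse_mul_cancel _ (spectrum.notMem_iff.1 hz)

theorem smul_resolvent_eq (hz : z ∉ spectrum ℂ A) :
    z • resolvent A z = 1 + A * resolvent A z := by
  have h := sub_mul_resolvent hz
  rw [sub_mul, ← Algebra.smul_def, sub_eq_iff_eq_add] at h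
  exact h

theorem resolvent_sub_resolvent (hz : z ∉ spectrum ℂ A) (hw : w ∉ spectrum ℂ A) :
    resolvent A z - resolvent A w = (w - z) • (resolvent A z * resolvent A w) := by
  have h : (w - z) • (1 : 𝒜) = (algebraMap ℂ 𝒜 w - A) - (algebraMap ℂ 𝒜 z - A) := by
    rw [← Algebra.algebraMap_eq_smul_one, map_sub]
    abel
  calc resolvent A z - resolvent A w
      = resolvent A z * ((algebraMap ℂ 𝒜 w - A) * resolvent A w) -
          (resolvent A z * (algebraMap ℂ 𝒜 z - A)) * resolvent A w := by
        rw [sub_mul_resolvent hw, resolvent_mul_sub hz, mul_one, one_mul]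
    _ = resolvent A z * ((w - z) • (1 : 𝒜)) * resolvent A w := by rw [h]; noncomm_ring
    _ = _ := by rw [mul_smul_comm, mul_one, smul_mul_assoc]

/-- A partial fraction decomposition, arranged for `holCalc_mul`: for fixed `z` the first term is a
scalar function of `w` times a fixed element, and for fixed `w` the second is a scalar function of
`z` times a fixed element. -/
theorem smul_resolvent_mul_smul_resolvent {z w : ℂ} (hz : z ∉ spectrum ℂ A)
    (hw : w ∉ spectrum ℂ A) (hzw : w ≠ z) (a b : ℂ) :
    (a • resolvent A z) * (b • resolvent A w) =
      ((w - z)⁻¹ * b) • a • resolvent A z - (a * (w - z)⁻¹) • b • resolvent A w := by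
  have h : resolvent A z * resolvent A w = (w - z)⁻¹ • (resolvent A z - resolvent A w) := by
    rw [resolvent_sub_resolvent hz hw, smul_smul, inv_mul_cancel₀ (sub_ne_zero.2 hzw), one_smul]
  rw [smul_mul_smul_comm, h]
  module

end ResolventIdentities

/-! ### Independence of the cycle, linearity and the unit -/

section Calculus

variable {𝒜 : Type*} [NormedRing 𝒜] [NormedAlgebra ℂ 𝒜] [CompleteSpace 𝒜] {A : 𝒜}

theorem differentiableOn_resolvent : DifferentiableOn ℂ (resolvent A) (spectrum ℂ A)ᶜ :=
  fun _ hz => (spectrum.hasDerivAt_resolvent_const_left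
    (not_not.1 hz)).differentiableAt.differentiableWithinAt

theorem LoopCycle.Surrounds.continuousOn_resolvent {Γ : LoopCycle} {Ω : Set ℂ}
    (h : LoopCycle.Surrounds Γ (spectrum ℂ A) Ω) :
    ContinuousOn (resolvent A) (LoopCycle.trace Γ) :=
  differentiableOn_resolvent.continuousOn.mono fun _ hz => (h.trace_subset hz).2

theorem exists_surrounds_spectrum {Ω : Set ℂ} (hΩ : IsOpen Ω) (hA : spectrum ℂ A ⊆ Ω) :
    ∃ Γ : LoopCycle, LoopCycle.Surrounds Γ (spectrum ℂ A) Ω := by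
  obtain ⟨Γ, hΓ, _⟩ := (spectrum.isCompact A).exists_surrounds_integral_eq_zero hΩ hA
  exact ⟨Γ, hΓ⟩

/-- Cauchy's theorem applies to `Γ₁ - Γ₂` in `(Ω₁ ∪ Ω₂) \ σ(A)`: the indices cancel as `1 - 1` on
the spectrum and as `0 - 0` outside both open sets. -/
theorem cauchyIntegralAlong_eq {f : ℂ → ℂ} {Γ₁ Γ₂ : LoopCycle} (h₁ : IsAdmissibleCycle A f Γ₁)
    (h₂ : IsAdmissibleCycle A f Γ₂) : cauchyIntegralAlong A f Γ₁ = cauchyIntegralAlong A f Γ₂ := by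
  obtain ⟨Ω₁, hΩ₁, hA₁, hf₁, hΓ₁⟩ := h₁
  obtain ⟨Ω₂, hΩ₂, hA₂, hf₂, hΓ₂⟩ := h₂
  have hindex : ∀ ζ, LoopCycle.index (Γ₁ - Γ₂) ζ =
      LoopCycle.index Γ₁ ζ - LoopCycle.index Γ₂ ζ := fun ζ => by
    rw [LoopCycle.index, LoopCycle.integral_sub_cycle, mul_sub, LoopCycle.index, LoopCycle.index]
  have h0 : LoopCycle.integral (Γ₁ - Γ₂) (fun z => f z • resolvent A z) = 0 := by
    refine LoopCycle.integral_eq_zero_of_index_eq_zero (U := (Ω₁ ∪ Ω₂) \ spectrum ℂ A)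
      ((hΩ₁.union hΩ₂).sdiff (spectrum.isClosed A)) ?_ (fun ζ hζ => ?_) ?_
    · refine (LoopCycle.trace_sub_subset _ _).trans (union_subset ?_ ?_)
      · exact hΓ₁.trace_subset.trans (sdiff_subset_sdiff_left subset_union_left)
      · exact hΓ₂.trace_subset.trans (sdiff_subset_sdiff_left subset_union_right)
    · rw [hindex]
      by_cases hζA : ζ ∈ spectrum ℂ A
      · rw [hΓ₁.index_eq_one ζ hζA, hΓ₂.index_eq_one ζ hζA, sub_self]
      · rw [hΓ₁.index_eq_zero ζ fun h => hζ ⟨Or.inl h, hζA⟩,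
          hΓ₂.index_eq_zero ζ fun h => hζ ⟨Or.inr h, hζA⟩, sub_self]
    · exact ((hf₁.union_of_isOpen hf₂ hΩ₁ hΩ₂).mono sdiff_subset).smul
        (differentiableOn_resolvent.mono fun z hz => hz.2)
  rw [LoopCycle.integral_sub_cycle, sub_eq_zero] at h0
  rw [cauchyIntegralAlong, cauchyIntegralAlong, h0]

theorem holCalc_eq_of_isAdmissibleCycle {f : ℂ → ℂ} {Γ : LoopCycle} (h : IsAdmissibleCycle A f Γ) :
    holCalc A f = cauchyIntegralAlong A f Γ := by
  have hex : ∃ Γ, IsAdmissibleCycle A f Γ := ⟨Γ, h⟩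
  rw [holCalc, dif_pos hex]
  exact cauchyIntegralAlong_eq hex.choose_spec h

theorem LoopCycle.Surrounds.holCalc_eq {f : ℂ → ℂ} {Γ : LoopCycle} {Ω : Set ℂ}
    (h : LoopCycle.Surrounds Γ (spectrum ℂ A) Ω) (hΩ : IsOpen Ω) (hA : spectrum ℂ A ⊆ Ω)
    (hf : DifferentiableOn ℂ f Ω) : holCalc A f = cauchyIntegralAlong A f Γ :=
  holCalc_eq_of_isAdmissibleCycle ⟨Ω, hΩ, hA, hf, h⟩

theorem holCalc_congr {f g : ℂ → ℂ} {Ω : Set ℂ} (hΩ : IsOpen Ω) (hA : spectrum ℂ A ⊆ Ω)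
    (hf : DifferentiableOn ℂ f Ω) (hfg : EqOn f g Ω) : holCalc A f = holCalc A g := by
  obtain ⟨Γ, hΓ⟩ := exists_surrounds_spectrum hΩ hA
  rw [hΓ.holCalc_eq hΩ hA hf, hΓ.holCalc_eq hΩ hA (hf.congr hfg.symm), cauchyIntegralAlong,
    cauchyIntegralAlong, LoopCycle.integral_congr Γ fun z hz => ?_]
  simp only [hfg (hΓ.trace_subset hz).1]

theorem holCalc_add {f g : ℂ → ℂ} (hf : HolomorphicNear (spectrum ℂ A) f)
    (hg : HolomorphicNear (spectrum ℂ A) g) :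
    holCalc A (fun z => f z + g z) = holCalc A f + holCalc A g := by
  obtain ⟨U, hU, hAU, hf⟩ := hf
  obtain ⟨V, hV, hAV, hg⟩ := hg
  have hf := hf.mono (inter_subset_left (t := V))
  have hg := hg.mono (inter_subset_right (s := U))
  have hUV := hU.inter hV
  have hA := subset_inter hAU hAV
  obtain ⟨Γ, hΓ⟩ := exists_surrounds_spectrum hUV hA
  have ht : LoopCycle.trace Γ ⊆ U ∩ V := hΓ.trace_subset.trans sdiff_subset
  rw [hΓ.holCalc_eq hUV hA hf, hΓ.holCalc_eq hUV hA hg,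
    hΓ.holCalc_eq (f := fun z => f z + g z) hUV hA (hf.add hg)]
  simp only [cauchyIntegralAlong, ← smul_add, add_smul]
  rw [← LoopCycle.integral_add Γ (g := fun z => f z • resolvent A z)
    (h := fun z => g z • resolvent A z)
    ((hf.continuousOn.mono ht).smul hΓ.continuousOn_resolvent)
    ((hg.continuousOn.mono ht).smul hΓ.continuousOn_resolvent)]

theorem holCalc_const_mul (c : ℂ) {f : ℂ → ℂ} (hf : HolomorphicNear (spectrum ℂ A) f) :
    holCalc A (fun z => c * f z) = c • holCalc A f := by
  obtain ⟨U, hU, hA, hf⟩ := hf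
  obtain ⟨Γ, hΓ⟩ := exists_surrounds_spectrum hU hA
  rw [hΓ.holCalc_eq hU hA hf, hΓ.holCalc_eq hU hA (hf.const_mul c)]
  simp only [cauchyIntegralAlong, mul_smul]
  rw [LoopCycle.integral_smul, smul_comm]

/-- For the constant function every large circle is admissible. There `resolvent A z - z⁻¹` equals
`z⁻¹ A (z - A)⁻¹`, of order `R⁻²`, while the length of the circle is of order `R`. -/
theorem norm_holCalc_one_sub_one_le : ∃ M : ℝ, ∀ᶠ R : ℝ in atTop,
    ‖holCalc A (fun _ => 1) - 1‖ ≤ M * R⁻¹ := by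
  obtain ⟨C, hC⟩ := (spectrum.resolvent_isBigO_inv (𝕜 := ℂ) A).bound
  obtain ⟨R₀, hR₀⟩ : ∃ R₀ : ℝ, ∀ z : ℂ, R₀ < ‖z‖ → ‖resolvent A z‖ ≤ C * ‖z⁻¹‖ := by
    obtain ⟨R₀, _, h⟩ := ((atTop_basis_Ioi (α := ℝ)).cobounded_of_norm).eventually_iff.1 hC
    exact ⟨R₀, fun z hz => h hz⟩
  obtain ⟨R₁, hR₁⟩ := (spectrum.isCompact (𝕜 := ℂ) A).isBounded.exists_norm_le
  refine ⟨‖A‖ * C, ?_⟩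
  filter_upwards [eventually_gt_atTop R₀, eventually_gt_atTop R₁, eventually_gt_atTop 0]
    with R h0 h1 hR
  have hΓ := surrounds_circleLoop hR.le (K := spectrum ℂ A) fun z hz => by
    rw [mem_ball_zero_iff]
    exact (hR₁ z hz).trans_lt h1
  have hne : ∀ z ∈ Metric.sphere (0 : ℂ) R, z ≠ 0 := fun z hz h => by
    rw [h, mem_sphere_zero_iff_norm, norm_zero] at hz
    exact hR.ne hz
  have hσ : ∀ z ∈ Metric.sphere (0 : ℂ) R, z ∉ spectrum ℂ A := fun z hz h => by
    have := hR₁ z h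
    rw [mem_sphere_zero_iff_norm] at hz
    linarith
  have hres : ContinuousOn (resolvent A) (Metric.sphere (0 : ℂ) R) :=
    differentiableOn_resolvent.continuousOn.mono hσ
  have hinv : ContinuousOn (fun z : ℂ => z⁻¹ • (1 : 𝒜)) (Metric.sphere 0 R) :=
    (continuousOn_inv₀.mono hne).smul continuousOn_const
  have hone : (2 * Real.pi * Complex.I : ℂ)⁻¹ • (∮ z in C(0, R), z⁻¹ • (1 : 𝒜)) = 1 := by
    have h2 := circleIntegral.integral_sub_inv_of_mem_ball (Metric.mem_ball_self (x := (0 : ℂ)) hR)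
    simp only [sub_zero] at h2
    rw [circleIntegral.integral_smul_const, h2, smul_smul,
      inv_mul_cancel₀ Complex.two_pi_I_ne_zero, one_smul]
  have hcalc : holCalc A (fun _ => 1) - 1 =
      (2 * Real.pi * Complex.I : ℂ)⁻¹ • ∮ z in C(0, R), (resolvent A z - z⁻¹ • (1 : 𝒜)) := by
    rw [circleIntegral.integral_sub (hres.circleIntegrable hR.le) (hinv.circleIntegrable hR.le),
      smul_sub, hone, hΓ.holCalc_eq isOpen_univ (subset_univ _) (differentiableOn_const 1),
      cauchyIntegralAlong, LoopCycle.integral_single, integral_circleLoop]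
    simp only [one_smul]
  rw [hcalc]
  refine (circleIntegral.norm_two_pi_i_inv_smul_integral_le_of_norm_le_const hR.le
    (C := ‖A‖ * (C * R⁻¹) * R⁻¹) fun z hz => ?_).trans (le_of_eq ?_)
  · have hz' : ‖z‖ = R := mem_sphere_zero_iff_norm.1 hz
    have e : resolvent A z - z⁻¹ • (1 : 𝒜) = z⁻¹ • (A * resolvent A z) := by
      have := congrArg (z⁻¹ • ·) (smul_resolvent_eq (hσ z hz))
      simp only [smul_smul, inv_mul_cancel₀ (hne z hz), one_smul, smul_add] at this
      exact sub_eq_of_eq_add' this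
    rw [e, norm_smul, norm_inv, hz', mul_comm]
    gcongr
    refine (norm_mul_le _ _).trans ?_
    gcongr
    have := hR₀ z (hz' ▸ h0)
    rwa [norm_inv, hz'] at this
  · field_simp

theorem holCalc_one : holCalc A (fun _ => 1) = 1 := by
  obtain ⟨M, hM⟩ := norm_holCalc_one_sub_one_le (A := A)
  have h : Tendsto (fun R : ℝ => M * R⁻¹) atTop (𝓝 0) := by
    simpa using tendsto_inv_atTop_zero.const_mul M
  exact sub_eq_zero.1 (norm_le_zero_iff.1 (ge_of_tendsto h hM))

/-- By `z (z - A)⁻¹ = 1 + A (z - A)⁻¹` the two sides differ by the integral of `f`, which vanishes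
since `f` is holomorphic across the spectrum. -/
theorem holCalc_id_mul {f : ℂ → ℂ} (hf : HolomorphicNear (spectrum ℂ A) f) :
    holCalc A (fun z => z * f z) = A * holCalc A f := by
  obtain ⟨U, hU, hA, hf⟩ := hf
  obtain ⟨Γ, hΓ⟩ := exists_surrounds_spectrum hU hA
  have ht : LoopCycle.trace Γ ⊆ U := hΓ.trace_subset.trans sdiff_subset
  have hc : ContinuousOn (fun z => f z • resolvent A z) (LoopCycle.trace Γ) :=
    (hf.continuousOn.mono ht).smul hΓ.continuousOn_resolvent
  rw [hΓ.holCalc_eq hU hA hf,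
    hΓ.holCalc_eq (f := fun z => z * f z) hU hA (differentiableOn_id.mul hf)]
  simp only [cauchyIntegralAlong]
  have h1 : EqOn (fun z => (z * f z) • resolvent A z)
      (fun z => f z • (1 : 𝒜) + A * (f z • resolvent A z)) (LoopCycle.trace Γ) := fun z hz => by
    simp only
    rw [mul_comm, mul_smul, smul_resolvent_eq (hΓ.trace_subset hz).2, smul_add, mul_smul_comm]
  have h2 := LoopCycle.map_integral Γ (ContinuousLinearMap.mul ℂ 𝒜 A) hc
  simp only [ContinuousLinearMap.mul_apply'] at h2
  have h3 : LoopCycle.integral Γ (fun z => f z • (1 : 𝒜)) = 0 :=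
    LoopCycle.integral_eq_zero_of_index_eq_zero hU ht hΓ.index_eq_zero (hf.smul_const 1)
  have h4 := LoopCycle.integral_add Γ (g := fun z => f z • (1 : 𝒜))
    (h := fun z => A * (f z • resolvent A z))
    ((hf.continuousOn.mono ht).smul continuousOn_const) (continuousOn_const.mul hc)
  rw [LoopCycle.integral_congr Γ h1, h4, h3, zero_add, mul_smul_comm, h2]

end Calculus
-- Products, spectral mapping, composition and power series
section Multiplicativity

variable {𝒜 : Type*} [NormedRing 𝒜] [NormedAlgebra ℂ 𝒜] [CompleteSpace 𝒜] {A : 𝒜}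

/-- Let `Γ₂` surround the hull of `Γ₁`, so that `Γ₂` has index one about the points of `Γ₁`, and
`Γ₁` index zero about those of `Γ₂`. The product is a double integral, split by the resolvent
identity: Cauchy's formula along `Γ₂` turns the first term into the integral for `f g`, and the
second vanishes after integrating over `Γ₁` first. -/
theorem holCalc_mul {f g : ℂ → ℂ} (hf : HolomorphicNear (spectrum ℂ A) f)
    (hg : HolomorphicNear (spectrum ℂ A) g) :
    holCalc A (fun z => f z * g z) = holCalc A f * holCalc A g := by
  obtain ⟨U, hU, hAU, hf⟩ := hf
  obtain ⟨V, hV, hAV, hg⟩ := hg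
  have hf := hf.mono (inter_subset_left (t := V))
  have hg := hg.mono (inter_subset_right (s := U))
  have hΩ := hU.inter hV
  have hA := subset_inter hAU hAV
  set Ω := U ∩ V
  obtain ⟨Γ₁, h₁⟩ := exists_surrounds_spectrum hΩ hA
  have ht₁ : LoopCycle.trace Γ₁ ⊆ Ω := h₁.trace_subset.trans sdiff_subset
  obtain ⟨Γ₂, h₂', -⟩ := (LoopCycle.isCompact_hull Γ₁).exists_surrounds_integral_eq_zero hΩ
    (LoopCycle.hull_subset ht₁ h₁.index_eq_zero)
  have h₂ : LoopCycle.Surrounds Γ₂ (spectrum ℂ A) Ω := h₂'.mono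
    -- The spectrum lies in the hull because `Γ₁` has index one there.
    (fun z hz => Or.inr (by rw [mem_ofPred_eq, h₁.index_eq_one z hz]; exact one_ne_zero))
    Subset.rfl
  have ht₂ : LoopCycle.trace Γ₂ ⊆ Ω := h₂.trace_subset.trans sdiff_subset
  have hdis : ∀ w ∈ LoopCycle.trace Γ₂, w ∉ LoopCycle.trace Γ₁ ∧ LoopCycle.index Γ₁ w = 0 :=
    fun w hw => ⟨fun h => (h₂'.trace_subset hw).2 (Or.inl h), by
      by_contra h
      exact (h₂'.trace_subset hw).2 (Or.inr h)⟩
  have hne : ∀ z ∈ LoopCycle.trace Γ₁, ∀ w ∈ LoopCycle.trace Γ₂, w ≠ z := fun z hz w hw h =>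
    (hdis w hw).1 (h ▸ hz)
  have hfc : ContinuousOn (fun z => f z • resolvent A z) (LoopCycle.trace Γ₁) :=
    (hf.continuousOn.mono ht₁).smul h₁.continuousOn_resolvent
  have hgc : ContinuousOn (fun w => g w • resolvent A w) (LoopCycle.trace Γ₂) :=
    (hg.continuousOn.mono ht₂).smul h₂.continuousOn_resolvent
  have hfgc : ContinuousOn (fun z => (f z * g z) • resolvent A z) (LoopCycle.trace Γ₁) :=
    ((hf.mul hg).continuousOn.mono ht₁).smul h₁.continuousOn_resolvent
  set c : ℂ := 2 * Real.pi * Complex.I with hc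
  set P := LoopCycle.integral Γ₁ fun z => f z • resolvent A z with hP
  set Q := LoopCycle.integral Γ₂ fun w => g w • resolvent A w with hQ
  have hinner : ∀ z ∈ LoopCycle.trace Γ₁, (f z • resolvent A z) * Q =
      c • (f z * g z) • resolvent A z -
        LoopCycle.integral Γ₂ fun w => (f z * (w - z)⁻¹) • g w • resolvent A w := by
    intro z hz
    have hz₂ : z ∉ LoopCycle.trace Γ₂ := fun h => hne z hz z h rfl
    have e1 : ContinuousOn (fun w => (w - z)⁻¹ * g w) (LoopCycle.trace Γ₂) :=
      (LoopCycle.continuousOn_inv_sub hz₂).mul (hg.continuousOn.mono ht₂)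
    have e2 := LoopCycle.map_integral Γ₂ (ContinuousLinearMap.mul ℂ 𝒜 (f z • resolvent A z)) hgc
    simp only [ContinuousLinearMap.mul_apply'] at e2
    rw [hQ, e2, LoopCycle.integral_congr Γ₂ fun w hw => smul_resolvent_mul_smul_resolvent
      (h₁.trace_subset hz).2 (h₂.trace_subset hw).2 (hne z hz w hw) (f z) (g w),
      LoopCycle.integral_sub Γ₂ (g := fun w => ((w - z)⁻¹ * g w) • f z • resolvent A z)
        (h := fun w => (f z * (w - z)⁻¹) • g w • resolvent A w) (e1.smul continuousOn_const)
        ((continuousOn_const.mul (LoopCycle.continuousOn_inv_sub hz₂)).smul hgc),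
      LoopCycle.integral_smul_const e1,
      LoopCycle.integral_inv_sub_mul hΩ ht₂ h₂.index_eq_zero hg (ht₁ hz) hz₂,
      h₂'.index_eq_one z (Or.inl hz)]
    congr 1
    module
  have hzero : LoopCycle.integral Γ₁ (fun z =>
      LoopCycle.integral Γ₂ fun w => (f z * (w - z)⁻¹) • g w • resolvent A w) = 0 := by
    rw [LoopCycle.integral_integral_swap]
    · have e3 : EqOn (fun w => LoopCycle.integral Γ₁ fun z => (f z * (w - z)⁻¹) • g w • resolvent A w)
          (fun _ => (0 : ℂ) • 0) (LoopCycle.trace Γ₂) := fun w hw => by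
        simp only [smul_zero]
        -- The only singularity of `z ↦ f z / (w - z)` in `Ω` is `w`, about which `Γ₁` has index
        -- zero.
        refine LoopCycle.integral_eq_zero_of_index_eq_zero (U := Ω \ {w})
          (hΩ.sdiff isClosed_singleton) (fun z hz => ⟨ht₁ hz, fun h => hne z hz w hw h.symm⟩)
          (fun ζ hζ => ?_) ?_
        · by_cases h : ζ ∈ Ω
          · have : ζ = w := by
              by_contra h'
              exact hζ ⟨h, h'⟩
            exact this ▸ (hdis w hw).2
          · exact h₁.index_eq_zero ζ h
        · refine DifferentiableOn.smul_const (DifferentiableOn.mul (hf.mono sdiff_subset)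
            (((differentiableOn_const w).sub differentiableOn_id).inv fun z hz h => hz.2 ?_)) _
          exact (sub_eq_zero.1 h).symm
      rw [LoopCycle.integral_congr Γ₂ e3, LoopCycle.integral_smul, zero_smul]
    · refine ContinuousOn.smul (ContinuousOn.mul ((hf.continuousOn.mono ht₁).comp continuousOn_fst
        fun p hp => hp.1) (ContinuousOn.inv₀ (by fun_prop) fun p hp h => ?_))
        (hgc.comp continuousOn_snd fun p hp => hp.2)
      exact hne _ hp.1 _ hp.2 (sub_eq_zero.1 h)
  have hPQ : P * Q = c • LoopCycle.integral Γ₁ fun z => (f z * g z) • resolvent A z := by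
    have e2 := LoopCycle.map_integral Γ₁ ((ContinuousLinearMap.mul ℂ 𝒜).flip Q) hfc
    simp only [ContinuousLinearMap.flip_apply, ContinuousLinearMap.mul_apply'] at e2
    have e4 : EqOn (fun z => LoopCycle.integral Γ₂ fun w => (f z * (w - z)⁻¹) • g w • resolvent A w)
        (fun z => c • (f z * g z) • resolvent A z - (f z • resolvent A z) * Q)
        (LoopCycle.trace Γ₁) := fun z hz => by
      simp only
      rw [hinner z hz, sub_sub_cancel]
    rw [LoopCycle.integral_congr Γ₁ e4, LoopCycle.integral_sub Γ₁
      (g := fun z => c • (f z * g z) • resolvent A z) (h := fun z => (f z • resolvent A z) * Q)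
      (hfgc.const_smul c) (hfc.mul continuousOn_const), LoopCycle.integral_smul, sub_eq_zero] at hzero
    rw [hP, e2, hzero]
  rw [h₁.holCalc_eq hΩ hA hf, h₂.holCalc_eq hΩ hA hg,
    h₁.holCalc_eq (f := fun z => f z * g z) hΩ hA (hf.mul hg), cauchyIntegralAlong,
    cauchyIntegralAlong, cauchyIntegralAlong, smul_mul_smul_comm, ← hc, ← hP, ← hQ, hPQ, smul_smul,
    mul_assoc, inv_mul_cancel₀ Complex.two_pi_I_ne_zero, mul_one]

theorem holomorphicNear_const (K : Set ℂ) (c : ℂ) : HolomorphicNear K fun _ => c :=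
  (holomorphicNearAlgebra K).algebraMap_mem c

theorem holCalc_const (c : ℂ) : holCalc A (fun _ => c) = algebraMap ℂ 𝒜 c := by
  have := holCalc_const_mul c (holomorphicNear_const (spectrum ℂ A) 1)
  rw [holCalc_one, ← Algebra.algebraMap_eq_smul_one] at this
  simpa using this

variable (A) in
/-- The holomorphic functional calculus as a homomorphism of algebras. -/
noncomputable def holCalcAlgHom : holomorphicNearAlgebra (spectrum ℂ A) →ₐ[ℂ] 𝒜 where
  toFun f := holCalc A f
  map_one' := holCalc_one
  map_mul' f g := holCalc_mul f.2 g.2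
  map_zero' := (holCalc_const 0).trans (map_zero _)
  map_add' f g := holCalc_add f.2 g.2
  commutes' := holCalc_const

theorem holCalcAlgHom_apply (f : holomorphicNearAlgebra (spectrum ℂ A)) :
    holCalcAlgHom A f = holCalc A f := rfl

/-- The identity function, as a function that is holomorphic near `K`. -/
def holomorphicNearId (K : Set ℂ) : holomorphicNearAlgebra K :=
  ⟨id, univ, isOpen_univ, subset_univ _, differentiableOn_id⟩

theorem holCalcAlgHom_id : holCalcAlgHom A (holomorphicNearId _) = A := by
  have := holCalc_id_mul (holomorphicNear_const (spectrum ℂ A) 1)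
  simp only [holCalc_one, mul_one] at this
  exact this

/-- Algebra homomorphisms commute with polynomials, and the identity function is mapped to `A`. -/
theorem holCalc_polynomial (q : ℂ[X]) : holCalc A (fun z => q.eval z) = Polynomial.aeval A q := by
  have h := Polynomial.aeval_algHom_apply (holCalcAlgHom A)
    (holomorphicNearId (spectrum ℂ A)) q
  rw [holCalcAlgHom_id] at h
  rw [h, holCalcAlgHom_apply]
  congr 1
  ext z
  have h1 := Polynomial.aeval_algHom_apply ((Pi.evalAlgHom ℂ (fun _ : ℂ => ℂ) z).comp
    (holomorphicNearAlgebra (spectrum ℂ A)).val) (holomorphicNearId (spectrum ℂ A)) q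
  exact (Polynomial.coe_aeval_eq_eval z ▸ rfl : q.eval z = Polynomial.aeval z q).trans h1

theorem HolomorphicNear.sub {K : Set ℂ} {f g : ℂ → ℂ} (hf : HolomorphicNear K f)
    (hg : HolomorphicNear K g) : HolomorphicNear K fun z => f z - g z :=
  (holomorphicNearAlgebra K).sub_mem hf hg

theorem holCalc_sub {f g : ℂ → ℂ} (hf : HolomorphicNear (spectrum ℂ A) f)
    (hg : HolomorphicNear (spectrum ℂ A) g) :
    holCalc A (fun z => f z - g z) = holCalc A f - holCalc A g :=
  map_sub (holCalcAlgHom A) ⟨f, hf⟩ ⟨g, hg⟩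

theorem HolomorphicNear.inv {K : Set ℂ} {f : ℂ → ℂ} (hf : HolomorphicNear K f)
    (h0 : ∀ z ∈ K, f z ≠ 0) : HolomorphicNear K fun z => (f z)⁻¹ := by
  obtain ⟨U, hU, hKU, hf⟩ := hf
  exact ⟨U ∩ f ⁻¹' {0}ᶜ, hf.continuousOn.isOpen_inter_preimage hU isOpen_compl_singleton,
    fun z hz => ⟨hKU hz, h0 z hz⟩, (hf.mono inter_subset_left).inv fun z hz => hz.2⟩

/-- The product `(f z)⁻¹ * f z` is `1` only where `f` does not vanish, hence the passage to a
smaller neighbourhood by `holCalc_congr`. -/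
theorem holCalc_inv_mul {f : ℂ → ℂ} (hf : HolomorphicNear (spectrum ℂ A) f)
    (h0 : ∀ z ∈ spectrum ℂ A, f z ≠ 0) : holCalc A (fun z => (f z)⁻¹) * holCalc A f = 1 := by
  rw [← holCalc_mul (hf.inv h0) hf, ← holCalc_one (A := A)]
  obtain ⟨U, hU, hAU, hf⟩ := hf
  refine (holCalc_congr (hf.continuousOn.isOpen_inter_preimage hU isOpen_compl_singleton)
    (fun z hz => ⟨hAU hz, h0 z hz⟩) (differentiableOn_const 1) fun z hz => ?_).symm
  exact (inv_mul_cancel₀ hz.2).symm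

theorem holCalc_mul_inv {f : ℂ → ℂ} (hf : HolomorphicNear (spectrum ℂ A) f)
    (h0 : ∀ z ∈ spectrum ℂ A, f z ≠ 0) : holCalc A f * holCalc A (fun z => (f z)⁻¹) = 1 := by
  rw [← holCalc_inv_mul hf h0, ← holCalc_mul (hf.inv h0) hf, ← holCalc_mul hf (hf.inv h0)]
  simp only [mul_comm]

theorem algebraMap_sub_holCalc {f : ℂ → ℂ} (hf : HolomorphicNear (spectrum ℂ A) f) (w : ℂ) :
    algebraMap ℂ 𝒜 w - holCalc A f = holCalc A fun z => w - f z := by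
  rw [holCalc_sub (holomorphicNear_const _ w) hf, holCalc_const]

theorem resolvent_holCalc {f : ℂ → ℂ} (hf : HolomorphicNear (spectrum ℂ A) f) {w : ℂ}
    (hw : w ∉ f '' spectrum ℂ A) :
    w ∉ spectrum ℂ (holCalc A f) ∧
      resolvent (holCalc A f) w = holCalc A fun z => (w - f z)⁻¹ := by
  have hh := (holomorphicNear_const (spectrum ℂ A) w).sub hf
  have h0 : ∀ z ∈ spectrum ℂ A, w - f z ≠ 0 := fun z hz h => hw ⟨z, hz, (sub_eq_zero.1 h).symm⟩
  have h1 := holCalc_inv_mul hh h0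
  have h2 := holCalc_mul_inv hh h0
  rw [← algebraMap_sub_holCalc hf] at h1 h2
  refine ⟨spectrum.notMem_iff.2 ⟨⟨_, _, h2, h1⟩, rfl⟩, ?_⟩
  exact Ring.inverse_unit ⟨_, _, h2, h1⟩

/-- The spectral mapping theorem. -/
theorem spectrum_holCalc {f : ℂ → ℂ} (hf : HolomorphicNear (spectrum ℂ A) f) :
    spectrum ℂ (holCalc A f) = f '' spectrum ℂ A := by
  refine Subset.antisymm (fun w hw => ?_) ?_
  · by_contra h
    exact (resolvent_holCalc hf h).1 hw
  · rintro _ ⟨μ, hμ, rfl⟩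
    by_contra h
    have hu := spectrum.notMem_iff.1 h
    obtain ⟨U, hU, hAU, hfU⟩ := id hf
    -- Since `f μ - f z = (μ - z) * dslope f μ z`, the element `μ - A` is one of two commuting
    -- factors of `f μ - f(A)`; were the latter invertible, so would be `μ - A`.
    have hd : HolomorphicNear (spectrum ℂ A) (dslope f μ) :=
      ⟨U, hU, hAU, (Complex.differentiableOn_dslope (hU.mem_nhds (hAU hμ))).2 hfU⟩
    have hl : HolomorphicNear (spectrum ℂ A) fun z => μ - z :=
      (holomorphicNear_const _ μ).sub (holomorphicNearId _).2
    have hlA : holCalc A (fun z => μ - z) = algebraMap ℂ 𝒜 μ - A := by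
      have := algebraMap_sub_holCalc (holomorphicNearId (spectrum ℂ A)).2 μ
      rw [← holCalcAlgHom_apply, holCalcAlgHom_id] at this
      exact this.symm
    have e : (fun z => f μ - f z) = fun z => (μ - z) * dslope f μ z := by
      ext z
      have := sub_smul_dslope f μ z
      rw [smul_eq_mul] at this
      linear_combination this
    have h1 : algebraMap ℂ 𝒜 (f μ) - holCalc A f =
        (algebraMap ℂ 𝒜 μ - A) * holCalc A (dslope f μ) := by
      rw [algebraMap_sub_holCalc hf, e, holCalc_mul hl hd, hlA]
    have hcomm : Commute (algebraMap ℂ 𝒜 μ - A) (holCalc A (dslope f μ)) := by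
      rw [← hlA, Commute, SemiconjBy, ← holCalc_mul hl hd, ← holCalc_mul hd hl]
      simp only [mul_comm]
    rw [h1, hcomm.isUnit_mul_iff] at hu
    exact spectrum.notMem_iff.2 hu.1 hμ

/-- For `w` on a cycle `Γ₂` around `σ(f(A))`, the resolvent of `f(A)` is the calculus of `A` applied
to `(w - f)⁻¹`, an integral over a cycle `Γ₁`. After interchanging the integrals, Cauchy's formula
along `Γ₂` produces `g (f z)`. -/
theorem holCalc_comp {Ω E : Set ℂ} {f g : ℂ → ℂ} (hΩ : IsOpen Ω) (hA : spectrum ℂ A ⊆ Ω)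
    (hf : DifferentiableOn ℂ f Ω) (hE : IsOpen E) (hfE : f '' Ω ⊆ E)
    (hg : DifferentiableOn ℂ g E) : holCalc A (g ∘ f) = holCalc (holCalc A f) g := by
  have hfA : HolomorphicNear (spectrum ℂ A) f := ⟨Ω, hΩ, hA, hf⟩
  have hσ := spectrum_holCalc hfA
  have hσE : spectrum ℂ (holCalc A f) ⊆ E := hσ ▸ (image_mono hA).trans hfE
  obtain ⟨Γ₂, h₂⟩ := exists_surrounds_spectrum hE hσE
  have ht₂ : LoopCycle.trace Γ₂ ⊆ E := h₂.trace_subset.trans sdiff_subset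
  -- Choosing `Γ₁` inside `f ⁻¹' V` ensures that `Γ₂` avoids `f z` and winds once about it for every
  -- `z` on `Γ₁`.
  set V : Set ℂ := {w | w ∉ LoopCycle.trace Γ₂ ∧ LoopCycle.index Γ₂ w = 1} with hV
  have hVo : IsOpen V := isOpen_iff_mem_nhds.2 fun w hw => by
    filter_upwards [LoopCycle.eventually_index_eq Γ₂ hw.1] with w' hw'
    exact ⟨hw'.1, hw'.2.trans hw.2⟩
  have hΩ' := hf.continuousOn.isOpen_inter_preimage hΩ hVo
  have hA' : spectrum ℂ A ⊆ Ω ∩ f ⁻¹' V := fun z hz => by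
    have hz' : f z ∈ spectrum ℂ (holCalc A f) := hσ ▸ mem_image_of_mem f hz
    exact ⟨hA hz, fun h => (h₂.trace_subset h).2 hz', h₂.index_eq_one _ hz'⟩
  obtain ⟨Γ₁, h₁⟩ := exists_surrounds_spectrum hΩ' hA'
  have ht₁ : LoopCycle.trace Γ₁ ⊆ Ω ∩ f ⁻¹' V := h₁.trace_subset.trans sdiff_subset
  have hf' := hf.mono (inter_subset_left (t := f ⁻¹' V))
  have hgf : DifferentiableOn ℂ (g ∘ f) (Ω ∩ f ⁻¹' V) :=
    hg.comp hf' fun z hz => hfE (mem_image_of_mem f hz.1)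
  have hne : ∀ z ∈ Ω ∩ f ⁻¹' V, ∀ w ∈ LoopCycle.trace Γ₂, w - f z ≠ 0 := fun z hz w hw h =>
    hz.2.1 (sub_eq_zero.1 h ▸ hw)
  set c : ℂ := 2 * Real.pi * Complex.I with hc
  have hres : ∀ w ∈ LoopCycle.trace Γ₂, resolvent (holCalc A f) w =
      c⁻¹ • LoopCycle.integral Γ₁ fun z => (w - f z)⁻¹ • resolvent A z := fun w hw => by
    rw [(resolvent_holCalc hfA (hσ ▸ (h₂.trace_subset hw).2)).2, h₁.holCalc_eq
      (f := fun z => (w - f z)⁻¹) hΩ' hA' (((differentiableOn_const w).sub hf').inv fun z hz => hne z hz w hw), cauchyIntegralAlong]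
  have hstep : LoopCycle.integral Γ₂ (fun w => g w • resolvent (holCalc A f) w) =
      LoopCycle.integral Γ₁ fun z => (g ∘ f) z • resolvent A z := by
    have e1 : EqOn (fun w => g w • resolvent (holCalc A f) w)
        (fun w => c⁻¹ • LoopCycle.integral Γ₁ fun z => ((w - f z)⁻¹ * g w) • resolvent A z)
        (LoopCycle.trace Γ₂) := fun w hw => by
      simp only
      rw [hres w hw, smul_comm, ← LoopCycle.integral_smul]
      simp only [smul_smul, mul_comm]
    rw [LoopCycle.integral_congr Γ₂ e1, LoopCycle.integral_smul, LoopCycle.integral_integral_swap]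
    · have e2 : EqOn (fun z => LoopCycle.integral Γ₂ fun w => ((w - f z)⁻¹ * g w) • resolvent A z)
          (fun z => c • (g ∘ f) z • resolvent A z) (LoopCycle.trace Γ₁) := fun z hz => by
        have hz' := ht₁ hz
        simp only
        rw [LoopCycle.integral_smul_const (φ := fun w => (w - f z)⁻¹ * g w) ((LoopCycle.continuousOn_inv_sub hz'.2.1).mul
          (hg.continuousOn.mono ht₂)), LoopCycle.integral_inv_sub_mul hE ht₂ h₂.index_eq_zero hg
          (hfE (mem_image_of_mem f hz'.1)) hz'.2.1, hz'.2.2, one_mul, mul_smul]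
        rfl
      rw [LoopCycle.integral_congr Γ₁ e2, LoopCycle.integral_smul, smul_smul,
        inv_mul_cancel₀ Complex.two_pi_I_ne_zero, one_smul]
    · have e3 : ContinuousOn (fun p : ℂ × ℂ => f p.2)
          (LoopCycle.trace Γ₂ ×ˢ LoopCycle.trace Γ₁) :=
        (hf'.continuousOn.mono ht₁).comp continuousOn_snd fun p hp => hp.2
      exact (((continuousOn_fst.sub e3).inv₀ fun p hp => hne _ (ht₁ hp.2) _ hp.1).mul
        ((hg.continuousOn.mono ht₂).comp continuousOn_fst fun p hp => hp.1)).smul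
        (h₁.continuousOn_resolvent.comp continuousOn_snd fun p hp => hp.2)
  rw [h₁.holCalc_eq hΩ' hA' hgf, h₂.holCalc_eq hE hσE hg, cauchyIntegralAlong,
    cauchyIntegralAlong, hstep]

/-- On a disc whose radius lies strictly between the spectral radius and the radius of convergence,
the finite partial sums converge uniformly to `f`; integration along a fixed cycle preserves this.
-/
theorem hasSum_holCalc {α : ℕ → ℂ} {f : ℂ → ℂ}
    (hR : spectralRadius ℂ A < (FormalMultilinearSeries.ofScalars ℂ α).radius)
    (hf : ∀ z : ℂ, ‖z‖ₑ < (FormalMultilinearSeries.ofScalars ℂ α).radius →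
      HasSum (fun n => α n * z ^ n) (f z)) :
    HasSum (fun n => α n • A ^ n) (holCalc A f) := by
  obtain ⟨r, hr1, hr2⟩ := ENNReal.lt_iff_exists_nnreal_btwn.1 hR
  have hσ : spectrum ℂ A ⊆ Metric.ball 0 r := fun z hz => by
    rw [mem_ball_zero_iff, ← coe_nnnorm, NNReal.coe_lt_coe, ← ENNReal.coe_lt_coe]
    exact (le_iSup₂ (α := ENNReal) z hz).trans_lt hr1
  have hu : Summable fun n => ‖α n‖ * (r : ℝ) ^ n := by
    simpa only [FormalMultilinearSeries.ofScalars_norm] using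
      (FormalMultilinearSeries.ofScalars ℂ α).summable_norm_mul_pow hr2
  have hbound : ∀ (n : ℕ) (z : ℂ), z ∈ Metric.ball (0 : ℂ) r →
      ‖α n * z ^ n‖ ≤ ‖α n‖ * (r : ℝ) ^ n := fun n z hz => by
    rw [norm_mul, norm_pow]
    gcongr
    exact (mem_ball_zero_iff.1 hz).le
  have hfz : ∀ z ∈ Metric.ball (0 : ℂ) r, HasSum (fun n => α n * z ^ n) (f z) := fun z hz => by
    refine hf z (lt_of_le_of_lt ?_ hr2)
    rw [← ofReal_norm, ← ENNReal.ofReal_coe_nnreal]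
    exact ENNReal.ofReal_le_ofReal (mem_ball_zero_iff.1 hz).le
  have hfd : DifferentiableOn ℂ f (Metric.ball 0 r) :=
    (Complex.differentiableOn_tsum_of_summable_norm hu (fun n => by fun_prop)
      Metric.isOpen_ball hbound).congr fun z hz => (hfz z hz).tsum_eq.symm
  obtain ⟨Γ, hΓ⟩ := exists_surrounds_spectrum Metric.isOpen_ball hσ
  have ht : LoopCycle.trace Γ ⊆ Metric.ball 0 r := hΓ.trace_subset.trans sdiff_subset
  have hunif : TendstoUniformlyOn (fun (s : Finset ℕ) z => ∑ n ∈ s, α n * z ^ n) f atTop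
      (Metric.ball 0 r) :=
    (tendstoUniformlyOn_tsum hu hbound).congr_right fun z hz => (hfz z hz).tsum_eq
  obtain ⟨C, hC0, hC⟩ := LoopCycle.exists_norm_integral_le (E := 𝒜) Γ
  obtain ⟨M, hM⟩ := (LoopCycle.isCompact_trace Γ).exists_bound_of_continuousOn
    hΓ.continuousOn_resolvent
  have hpoly : ∀ s : Finset ℕ, ∑ n ∈ s, α n • A ^ n =
      holCalc A fun z => ∑ n ∈ s, α n * z ^ n := fun s => by
    have := holCalc_polynomial (A := A) (∑ n ∈ s, Polynomial.monomial n (α n))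
    simpa [Polynomial.eval_finsetSum, Polynomial.aeval_monomial, Algebra.smul_def] using this.symm
  rw [HasSum, SummationFilter.unconditional_filter]
  simp only [hpoly]
  refine Metric.tendsto_nhds.2 fun ε hε => ?_
  set c : ℂ := 2 * Real.pi * Complex.I with hc
  -- A uniform error `η` of the functions changes the Cauchy integral by at most `D * η`. The bound
  -- `M` need not be nonnegative, hence `|M|`; the tolerance `ε / (D + 1)` also covers `D = 0`.
  set D : ℝ := ‖c⁻¹‖ * (C * |M|) with hD
  have hD0 : 0 ≤ D := by positivity
  filter_upwards [Metric.tendstoUniformlyOn_iff.1 hunif (ε / (D + 1)) (by positivity)] with s hs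
  have hpd : DifferentiableOn ℂ (fun z => ∑ n ∈ s, α n * z ^ n) (Metric.ball (0 : ℂ) r) := by
    fun_prop
  rw [dist_comm, dist_eq_norm, hΓ.holCalc_eq Metric.isOpen_ball hσ hfd,
    hΓ.holCalc_eq Metric.isOpen_ball hσ hpd, cauchyIntegralAlong, cauchyIntegralAlong, ← smul_sub,
    ← LoopCycle.integral_sub Γ (g := fun z => f z • resolvent A z)
      (h := fun z => (∑ n ∈ s, α n * z ^ n) • resolvent A z)
      ((hfd.continuousOn.mono ht).smul hΓ.continuousOn_resolvent)
      ((hpd.continuousOn.mono ht).smul hΓ.continuousOn_resolvent), norm_smul]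
  have h1 := hC (fun z => f z • resolvent A z - (∑ n ∈ s, α n * z ^ n) • resolvent A z)
    (ε / (D + 1) * |M|) fun z hz => by
      rw [← sub_smul, norm_smul, ← dist_eq_norm]
      exact mul_le_mul (hs z (ht hz)).le ((hM z hz).trans (le_abs_self M)) (norm_nonneg _)
        (by positivity)
  calc _ ≤ ‖c⁻¹‖ * (C * (ε / (D + 1) * |M|)) := by gcongr
    _ = ε * (D / (D + 1)) := by rw [hD]; ring
    _ < ε * 1 := by
      gcongr
      rw [div_lt_one (by positivity)]
      linarith
    _ = ε := mul_one ε

end Multiplicativity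

theorem mainTheorem11 {𝒜 : Type*} [NormedRing 𝒜] [NormedAlgebra ℂ 𝒜] [NormOneClass 𝒜]
    [CompleteSpace 𝒜] (A : 𝒜) :
    -- the definition of `f(A)` makes sense: in every open neighbourhood of the spectrum there is a
    -- cycle that may be used, and every cycle that may be used gives the same value
    (∀ Ω : Set ℂ, IsOpen Ω → spectrum ℂ A ⊆ Ω →
      ∃ Γ : LoopCycle, LoopCycle.Surrounds Γ (spectrum ℂ A) Ω) ∧
    (∀ (f : ℂ → ℂ) (Γ : LoopCycle), IsAdmissibleCycle A f Γ →
      holCalc A f = cauchyIntegralAlong A f Γ) ∧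
    -- (i) polynomials and power series
    (∀ q : ℂ[X], holCalc A (fun z => q.eval z) = Polynomial.aeval A q) ∧
    (∀ (α : ℕ → ℂ) (f : ℂ → ℂ),
      spectralRadius ℂ A < (FormalMultilinearSeries.ofScalars ℂ α).radius →
      (∀ z : ℂ, ‖z‖ₑ < (FormalMultilinearSeries.ofScalars ℂ α).radius →
        HasSum (fun n => α n * z ^ n) (f z)) →
      HasSum (fun n => α n • A ^ n) (holCalc A f)) ∧
    -- (ii) algebra homomorphism
    (∃ Φ : holomorphicNearAlgebra (spectrum ℂ A) →ₐ[ℂ] 𝒜,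
      ∀ f : holomorphicNearAlgebra (spectrum ℂ A), Φ f = holCalc A (f : ℂ → ℂ)) ∧
    -- (iii) spectral mapping theorem
    (∀ f : ℂ → ℂ, HolomorphicNear (spectrum ℂ A) f →
      spectrum ℂ (holCalc A f) = f '' spectrum ℂ A) ∧
    -- (iv) composition
    (∀ (Ω E : Set ℂ) (f g : ℂ → ℂ), IsOpen Ω → spectrum ℂ A ⊆ Ω → DifferentiableOn ℂ f Ω →
      IsOpen E → f '' Ω ⊆ E → DifferentiableOn ℂ g E →
      holCalc A (g ∘ f) = holCalc (holCalc A f) g) := by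
  refine ⟨fun Ω hΩ hA => exists_surrounds_spectrum hΩ hA,
    fun f Γ hΓ => holCalc_eq_of_isAdmissibleCycle hΓ, holCalc_polynomial,
    fun α f hR hf => hasSum_holCalc hR hf, ⟨holCalcAlgHom A, holCalcAlgHom_apply⟩,
    fun f hf => spectrum_holCalc hf,
    fun Ω E f g hΩ hA hf hE hfE hg => holCalc_comp hΩ hA hf hE hfE hg⟩
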